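/- **Setting.** A noisy circuit consists of $n$ qudits of local dimension $h\ge 1$ and $d$ layers. In layer $j$ the qudits are partitioned into disjoint blocks of at most $k$ qudits, and $U_j$ is the tensor product of arbitrary unitary gates on these blocks (an idle qudit is a block of size one with the identity gate). Starting from $|0\rangle\langle 0|^{\otimes n}$, each $U_j$ ($j=1,\dots,d$) is applied and is followed by the depolarizing channel $\mathcal N_p[\rho]=(1-p)\rho+\frac{p}{h}I\,\mathrm{Tr}\rho$ on every qudit; $P$ denotes the distribution of the outcome of measuring all qudits in the computational basis. Put $q=1-p\in[0,1]$. The interaction graph $G=(V,E)$ has vertices $V=[n]\times[d]$. Two distinct vertices $(i,j),(i',j')$ are adjacent if $j=j'$ and some gate in $U_j$ or in $U_{j+1}$ acts on both $i$ and $i'$, or if $|j-j'|=1$ and some gate in $U_{\max(j,j')}$ acts on both $i$ and $i'$. Let $\mathfrak d$ be the maximum degree of $G$. For $L\subseteq[n]$ let $\partial_G L$ be the set of edges of $G$ joining $\{(i,j):i\in L\}$ to its complement. For $A,C\subseteq[n]$ let $l_{AC}\in\mathbb N\cup\{\infty\}$ be the graph distance between $\{(i,j):i\in A\}$ and $\{(i,j):i\in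 C\}$. With $H_P(X)$ the Shannon entropy of the marginal of $P$ on $X$, let $I_P(A:C|B)=H_P(AB)+H_P(BC)-H_P(B)-H_P(ABC)$. **Theorem.** Let $$q_c=q_c(h,k,\mathfrak d)=\left[\,2h^k\,(1+e(\mathfrak d-1))\cdot 2e(\mathfrak d+1)\right]^{-1}.$$ There are absolute constants $c,K>0$ such that for all $h\ge 1$, $k$, $\mathfrak d$ and all $q$ with $0\le q\le q_c$ there is $\xi>0$, depending only on $h,k,\mathfrak d,q$, with $\xi\cdot\log(q_c/q)\le K$ (no constraint on $\xi$ if $q=0$), i.e. $\xi=O(1/\log(q_c/q))$, such that for every noisy circuit as above whose interaction graph has maximum degree $\mathfrak d$ (any $n$, $d$ and gates), and all pairwise disjoint $A,B,C\subseteq[n]$, $$I_P(A:C|B)\;\le\; c\cdot\min(|\partial_G A|,|\partial_G C|)\cdot\exp(-l_{AC}/\xi),$$ where $\exp(-\infty)=0$. -/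

import Mathlib

open scoped Matrix

/-- Operators on `n` qudits of local dimension `h`, as matrices in the computational basis. -/
abbrev QOp (h n : ℕ) := Matrix (Fin n → Fin h) (Fin n → Fin h) ℂ

/-- Depolarizing channel of rate `p` on qudit `i`:
`ρ ↦ (1 - p) ρ + (p / h) I_i ⊗ Tr_i ρ`. -/
noncomputable def depolarize {h n : ℕ} (p : ℝ) (i : Fin n) (ρ : QOp h n) : QOp h n :=
  Matrix.of fun x y =>
    ((1 - p : ℝ) : ℂ) * ρ x y +
      ((p / h : ℝ) : ℂ) *
        (if x i = y i then ∑ a : Fin h, ρ (Function.update x i a) (Function.update y i a) else 0)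

/-- A layer of noise: the depolarizing channel of rate `p` applied to every qudit. -/
noncomputable def depolarizeAll {h n : ℕ} (p : ℝ) (ρ : QOp h n) : QOp h n :=
  (List.finRange n).foldl (fun σ i => depolarize p i σ) ρ

/-- The pure state `|0 … 0⟩⟨0 … 0|`. -/
def zeroState (h n : ℕ) [NeZero h] : QOp h n :=
  Matrix.of fun x y => if x = (fun _ => 0) ∧ y = (fun _ => 0) then 1 else 0

/-- The unitary part of a circuit with `d` layers of gates, each on at most `k` of `n` qudits of
dimension `h`. The gates of layer `j` act on the blocks of a partition of the qudits; a qudit on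
which nothing happens in that layer is a block of size one with the identity gate.
Only the values `gate j s` with `s` a block of layer `j` are ever used. -/
structure LayeredCircuit (h k n d : ℕ) where
  /-- the supports of the gates of each layer -/
  blocks : Fin d → Finpartition (Finset.univ : Finset (Fin n))
  /-- every gate acts on at most `k` qudits -/
  card_le : ∀ j, ∀ s ∈ (blocks j).parts, s.card ≤ k
  /-- the gate of layer `j` on block `s` -/
  gate : Fin d → (s : Finset (Fin n)) → Matrix.unitaryGroup (s → Fin h) ℂ

namespace LayeredCircuit

variable {h k n d : ℕ} (𝒞 : LayeredCircuit h k n d)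

/-- The unitary `U_j` of layer `j`: the tensor product of the gates of that layer. -/
def layerUnitary (j : Fin d) : QOp h n :=
  Matrix.of fun x y =>
    ∏ s ∈ (𝒞.blocks j).parts,
      (𝒞.gate j s : Matrix (s → Fin h) (s → Fin h) ℂ) (fun i => x i) (fun i => y i)

/-- The output state of the noisy circuit: starting from `|0 … 0⟩⟨0 … 0|`, each layer of gates is
followed by depolarizing noise of rate `p` on all qudits. -/
noncomputable def outputState [NeZero h] (p : ℝ) : QOp h n :=
  (List.finRange d).foldl
    (fun ρ j => depolarizeAll p (𝒞.layerUnitary j * ρ * (𝒞.layerUnitary j)ᴴ)) (zeroState h n)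

/-- The distribution of the outcome of measuring all qudits in the computational basis. -/
noncomputable def measurementDist [NeZero h] (p : ℝ) (x : Fin n → Fin h) : ℝ :=
  (𝒞.outputState p x x).re

/-- Some gate of layer `j` acts on both qudits `i` and `i'`. -/
def SameGate (j : Fin d) (i i' : Fin n) : Prop :=
  ∃ s ∈ (𝒞.blocks j).parts, i ∈ s ∧ i' ∈ s

/-- The interaction graph. The vertex `(i, j)` is the noise channel on qudit `i` right after the
gates of layer `j`. Distinct vertices are adjacent if they lie in the same noise layer and a gate
right before or right after that noise layer acts on both qudits, or if they lie in consecutive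
noise layers and a gate between the two acts on both qudits. -/
def interactionGraph : SimpleGraph (Fin n × Fin d) :=
  SimpleGraph.fromRel fun v w =>
    (v.2 = w.2 ∧ 𝒞.SameGate v.2 v.1 w.1) ∨
    (v.2 = w.2 ∧ ∃ j : Fin d, (j : ℕ) = v.2 + 1 ∧ 𝒞.SameGate j v.1 w.1) ∨
    ((w.2 : ℕ) = v.2 + 1 ∧ 𝒞.SameGate w.2 v.1 w.1)

open Classical in
/-- The (maximum) degree of the interaction graph. -/
noncomputable def degree : ℕ := 𝒞.interactionGraph.maxDegree

/-- The distance in the interaction graph between two regions of qudits; it is `⊤` if no path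
joins them. -/
noncomputable def regionDist (A C : Finset (Fin n)) : ℕ∞ :=
  ⨅ (v : Fin n × Fin d) (w : Fin n × Fin d) (_ : v.1 ∈ A) (_ : w.1 ∈ C),
    𝒞.interactionGraph.edist v w

/-- The edge boundary of a region of qudits in the interaction graph. -/
def edgeBoundary (L : Finset (Fin n)) : Set (Sym2 (Fin n × Fin d)) :=
  {e | e ∈ 𝒞.interactionGraph.edgeSet ∧ ∃ v w, e = s(v, w) ∧ v.1 ∈ L ∧ w.1 ∉ L}

end LayeredCircuit

/-- The marginal on the region `L` of a function on configurations. -/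
def marginal {h n : ℕ} (P : (Fin n → Fin h) → ℝ) (L : Finset (Fin n)) (y : L → Fin h) : ℝ :=
  ∑ x : Fin n → Fin h, if (fun i : L => x i) = y then P x else 0

/-- The Shannon entropy (in nats) of the marginal on `L`. -/
noncomputable def marginalEntropy {h n : ℕ} (P : (Fin n → Fin h) → ℝ) (L : Finset (Fin n)) : ℝ :=
  ∑ y : L → Fin h, Real.negMulLog (marginal P L y)

/-- The conditional mutual information `I_P(A : C | B)`. -/
noncomputable def condMutualInfo {h n : ℕ} (P : (Fin n → Fin h) → ℝ) (A B C : Finset (Fin n)) : ℝ :=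
  marginalEntropy P (A ∪ B) + marginalEntropy P (B ∪ C) - marginalEntropy P B -
    marginalEntropy P (A ∪ B ∪ C)

/-- The threshold `q_c = [2 h^k (1 + e (𝔡 - 1)) · 2 e (𝔡 + 1)]⁻¹`. -/
noncomputable def qCrit (h k 𝔡 : ℕ) : ℝ :=
  (2 * (h : ℝ) ^ k * (1 + Real.exp 1 * ((𝔡 : ℝ) - 1)) * (2 * Real.exp 1 * ((𝔡 : ℝ) + 1)))⁻¹

/-- `exp (-l / ξ)`, with the value `0` at `l = ∞`. -/
noncomputable def expDecay (l : ℕ∞) (ξ : ℝ) : ℝ :=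
  if l = ⊤ then 0 else Real.exp (-(l.toNat : ℝ) / ξ)

/-! The noise on a qudit is `dep i + q (1 - dep i)`, where `dep i` is complete depolarization.
Expanding this at every noise location in the Heisenberg picture gives `hⁿ P(x) = ∑_S q^|S| w_x(S)`,
where `S` is the set of locations at which `1 - dep i` is selected (`measurementDist_eq`).
Depolarized locations cut the circuit, so `w_x` is multiplicative over disjoint non-adjacent sets
(`weight_union`); moreover `|w_x(S)| ≤ (2h)^|S|` (`weight_bound`). Summing over the outcomes of a
qudit kills every `S` containing its last-layer location, so each marginal is `h^(-|L|)` times the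
partition function of the same weight on a smaller set of locations (`marginal_eq`). For each fixed
`x` this is a polymer gas on the interaction graph.

The gas is controlled through ratios of partition functions rather than a cluster expansion of the
logarithm. Adding a vertex `v` to `U` changes `Z` by a sum over connected sets containing `v`
(`Z_insert`). One induction shows that `Z` is positive and that these ratios are bounded below
(`Regime.pos_and_erase_le`); another shows that the ratio at `v` feels a change of `U` at distance
at least `m` by at most `3 θ^m` (`Regime.abs_ratio_sub_le`).

The powers of `h` cancel in the conditional mutual information, which becomes the mean over `x` of a
mixed second difference of `log Z`: one difference switches the outcomes on `A`, the other those on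
`C`. Deleting the locations of `A` that have neighbours outside makes `Z` factor, and the mixed
difference vanishes. The deletion costs one log-ratio per boundary vertex, compared between two
environments that differ only over `C`, hence far away (`Regime.abs_cross_le`). -/

set_option linter.unusedSectionVars false

/-! ### Partition functions and their expansion in connected sets -/

namespace PolymerGas

open Finset

variable {V : Type*} [Fintype V] [DecidableEq V] (G : SimpleGraph V)

/-- The subgraph of `G` formed by the edges inside `S`. -/
def within (S : Finset V) : SimpleGraph V where
  Adj a b := G.Adj a b ∧ a ∈ S ∧ b ∈ S
  symm := ⟨fun _ _ h => ⟨h.1.symm, h.2.2, h.2.1⟩⟩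
  loopless := ⟨fun _ h => G.loopless.irrefl _ h.1⟩

/-- `γ` contains `v` and is connected. -/
def IsAnimal (v : V) (γ : Finset V) : Prop :=
  v ∈ γ ∧ ∀ u ∈ γ, (within G γ).Reachable v u

open Classical in
/-- The connected component of `v` in `S`. -/
noncomputable def component (v : V) (S : Finset V) : Finset V :=
  S.filter fun u => (within G S).Reachable v u

open Classical in
/-- The closed neighbourhood of `γ`. -/
noncomputable def nbhd (γ : Finset V) : Finset V :=
  univ.filter fun u => u ∈ γ ∨ ∃ a ∈ γ, G.Adj a u

open Classical in
/-- The connected sets inside `insert v U` that contain `v`. -/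
noncomputable def animals (v : V) (U : Finset V) : Finset (Finset V) :=
  (insert v U).powerset.filter fun γ => IsAnimal G v γ

/-- The partition function of the weight `f` on the region `U`. -/
def Z (f : Finset V → ℝ) (U : Finset V) : ℝ := ∑ S ∈ U.powerset, f S

/-- `f` factorizes over non-adjacent sets. -/
structure Factorizes (f : Finset V → ℝ) : Prop where
  empty : f ∅ = 1
  union : ∀ S T : Finset V, Disjoint S T → (∀ a ∈ S, ∀ b ∈ T, ¬ G.Adj a b) →
    f (S ∪ T) = f S * f T

variable {G}

theorem within_mono {S T : Finset V} (h : S ⊆ T) : within G S ≤ within G T :=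
  fun _ _ hab => ⟨hab.1, h hab.2.1, h hab.2.2⟩

theorem reachable_within_of_closed {S γ : Finset V} {v u : V} (hv : v ∈ γ)
    (hcl : ∀ a ∈ γ, ∀ b ∈ S, G.Adj a b → b ∈ γ) (h : (within G S).Reachable v u) :
    u ∈ γ ∧ (within G γ).Reachable v u := by
  obtain ⟨p⟩ := h
  induction p with
  | nil => exact ⟨hv, SimpleGraph.Reachable.refl _⟩
  | cons hab p ih =>
    have hb := hcl _ hv _ hab.2.2 hab.1
    obtain ⟨h1, h2⟩ := ih hb
    exact ⟨h1, (SimpleGraph.Adj.reachable (G := within G γ) ⟨hab.1, hv, hb⟩).trans h2⟩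

theorem component_closed {v : V} {S : Finset V} :
    ∀ a ∈ component G v S, ∀ b ∈ S, G.Adj a b → b ∈ component G v S := by
  classical
  intro a ha b hb hab
  simp only [component, mem_filter] at ha ⊢
  exact ⟨hb, ha.2.trans (SimpleGraph.Adj.reachable (G := within G S) ⟨hab, ha.1, hb⟩)⟩

theorem component_subset (v : V) (S : Finset V) : component G v S ⊆ S := by
  classical
  exact filter_subset _ _

theorem isAnimal_component {v : V} {S : Finset V} (hv : v ∈ S) :
    IsAnimal G v (component G v S) := by
  classical
  have hv' : v ∈ component G v S := by
    simp [component, hv]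
  refine ⟨hv', fun u hu => ?_⟩
  exact (reachable_within_of_closed hv' component_closed (mem_filter.1 hu).2).2

theorem disjoint_nbhd_iff {S γ : Finset V} :
    Disjoint S (nbhd G γ) ↔ Disjoint γ S ∧ ∀ a ∈ γ, ∀ b ∈ S, ¬ G.Adj a b := by
  classical
  simp only [Finset.disjoint_left, nbhd, mem_filter, mem_univ, true_and, not_or, not_exists,
    not_and]
  constructor
  · intro h
    exact ⟨fun a ha hS => (h hS).1 ha, fun a ha b hb => (h hb).2 a ha⟩
  · intro h a ha
    exact ⟨fun hg => h.1 hg ha, fun b hb => h.2 b hb a ha⟩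

theorem component_union {v : V} {γ S : Finset V} (hγ : IsAnimal G v γ)
    (hS : Disjoint S (nbhd G γ)) : component G v (γ ∪ S) = γ := by
  classical
  obtain ⟨-, h2⟩ := disjoint_nbhd_iff.1 hS
  ext u
  constructor
  · intro hu
    refine (reachable_within_of_closed hγ.1 ?_ (mem_filter.1 hu).2).1
    intro a ha b hb hab
    rcases mem_union.1 hb with hb | hb
    · exact hb
    · exact absurd hab (h2 a ha b hb)
  · intro hu
    exact mem_filter.2 ⟨mem_union_left _ hu, (hγ.2 u hu).mono (within_mono subset_union_left)⟩

/-- Expansion of the partition function in the connected sets that contain a new vertex. -/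
theorem Z_insert {f : Finset V → ℝ} (hf : Factorizes G f) {v : V} {U : Finset V} (hv : v ∉ U) :
    Z f (insert v U) = Z f U + ∑ γ ∈ animals G v U, f γ * Z f (U \ nbhd G γ) := by
  classical
  unfold Z
  rw [sum_powerset_insert hv]
  congr 1
  -- With `v` restored, `insert v S` splits uniquely into the component `γ` of `v` and a remainder
  -- that avoids the closed neighbourhood of `γ`. The sum is grouped by `γ`.
  have hmaps : ∀ S ∈ U.powerset, component G v (insert v S) ∈ animals G v U := by
    intro S hS
    refine mem_filter.2 ⟨mem_powerset.2 ?_, isAnimal_component (mem_insert_self _ _)⟩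
    exact (component_subset _ _).trans (insert_subset_insert _ (mem_powerset.1 hS))
  rw [← sum_fiberwise_of_maps_to hmaps]
  refine sum_congr rfl fun γ hγ => ?_
  obtain ⟨hγU, hγ⟩ := mem_filter.1 hγ
  rw [mem_powerset] at hγU
  rw [mul_sum]
  symm
  refine sum_bij' (fun T _ => (γ ∪ T).erase v) (fun S _ => S \ γ) ?_ ?_ ?_ ?_ ?_
  · intro T hT
    rw [mem_powerset, subset_sdiff] at hT
    rw [mem_filter, mem_powerset, insert_erase (mem_union_left _ hγ.1)]
    refine ⟨?_, component_union hγ hT.2⟩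
    rw [← subset_insert_iff]
    exact union_subset hγU (hT.1.trans (subset_insert _ _))
  · intro S hS
    obtain ⟨hS, hc⟩ := mem_filter.1 hS
    rw [mem_powerset] at hS ⊢
    rw [subset_sdiff]
    refine ⟨sdiff_subset.trans hS, disjoint_nbhd_iff.2 ⟨disjoint_sdiff, ?_⟩⟩
    intro a ha b hb hab
    rw [mem_sdiff] at hb
    subst hc
    exact hb.2 (component_closed a ha b (mem_insert_of_mem hb.1) hab)
  · intro T hT
    rw [mem_powerset, subset_sdiff] at hT
    have hd := (disjoint_nbhd_iff.1 hT.2).1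
    ext u
    simp only [mem_sdiff, mem_erase, mem_union]
    constructor
    · rintro ⟨⟨-, h | h⟩, h'⟩
      · exact absurd h h'
      · exact h
    · intro h
      have := Finset.disjoint_right.1 hd h
      exact ⟨⟨fun e => this (e ▸ hγ.1), Or.inr h⟩, this⟩
  · intro S hS
    obtain ⟨hS, hc⟩ := mem_filter.1 hS
    rw [mem_powerset] at hS
    have hvS : v ∉ S := fun h => hv (hS h)
    have hsub : γ ⊆ insert v S := hc ▸ component_subset _ _
    ext u
    simp only [mem_erase, mem_union, mem_sdiff]
    constructor
    · rintro ⟨h1, h2 | h2⟩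
      · exact mem_of_mem_insert_of_ne (hsub h2) h1
      · exact h2.1
    · intro h
      refine ⟨fun e => hvS (e ▸ h), ?_⟩
      by_cases hγu : u ∈ γ
      · exact Or.inl hγu
      · exact Or.inr ⟨h, hγu⟩
  · intro T hT
    rw [mem_powerset, subset_sdiff] at hT
    rw [insert_erase (mem_union_left _ hγ.1)]
    have := disjoint_nbhd_iff.1 hT.2
    exact (hf.union _ _ this.1 this.2).symm

theorem Z_union {f : Finset V → ℝ} (hf : Factorizes G f) {X Y : Finset V} (hd : Disjoint X Y)
    (hadj : ∀ a ∈ X, ∀ b ∈ Y, ¬ G.Adj a b) : Z f (X ∪ Y) = Z f X * Z f Y := by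
  classical
  unfold Z
  rw [sum_mul_sum, ← sum_product']
  symm
  refine sum_bij' (fun p _ => p.1 ∪ p.2) (fun S _ => (S ∩ X, S ∩ Y)) ?_ ?_ ?_ ?_ ?_
  · intro p hp
    simp only [mem_product, mem_powerset] at hp ⊢
    exact union_subset_union hp.1 hp.2
  · intro S _
    simp only [mem_product, mem_powerset]
    exact ⟨inter_subset_right, inter_subset_right⟩
  · rintro ⟨S, T⟩ hp
    simp only [mem_product, mem_powerset] at hp
    have h1 : Disjoint S Y := hd.mono_left hp.1
    have h2 : Disjoint T X := (hd.mono_right hp.2).symm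
    simp only [union_inter_distrib_right, inter_eq_left.2 hp.1,
      inter_eq_left.2 hp.2, disjoint_iff_inter_eq_empty.1 h1, disjoint_iff_inter_eq_empty.1 h2,
      union_empty, empty_union]
  · intro S hS
    rw [mem_powerset] at hS
    simp only [← inter_union_distrib_left]
    exact inter_eq_left.2 hS
  · rintro ⟨S, T⟩ hp
    simp only [mem_product, mem_powerset] at hp
    exact (hf.union _ _ (hd.mono hp.1 hp.2)
      (fun a ha b hb => hadj a (hp.1 ha) b (hp.2 hb))).symm

/-! ### Counting connected sets through a solvable weight -/

theorem Z_pow_card (y : ℝ) (U : Finset V) : Z (fun S => y ^ S.card) U = (1 + y) ^ U.card := by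
  have := Finset.prod_add (fun _ : V => y) (fun _ => (1 : ℝ)) U
  simp only [prod_const, one_pow, mul_one] at this
  rw [Z, ← this, add_comm]

theorem factorizes_pow_card (y : ℝ) : Factorizes G (fun S => y ^ S.card) where
  empty := by simp
  union S T h _ := by simp only [card_union_of_disjoint h, pow_add]

theorem IsAnimal.exists_adj {v u : V} {γ : Finset V} (h : IsAnimal G v γ) (hu : u ∈ γ)
    (huv : u ≠ v) : ∃ a ∈ γ, G.Adj a u := by
  obtain ⟨p⟩ := (h.2 u hu).symm
  cases p with
  | nil => exact absurd rfl huv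
  | cons hab p => exact ⟨_, hab.2.2, hab.1.symm⟩

open Classical in
/-- The vertices adjacent to `v`. -/
noncomputable def nbrs (G : SimpleGraph V) (v : V) : Finset V := univ.filter (G.Adj v)

/-- Since `v ∉ U`, a vertex of `U` lying in `γ` is not the root, so connectedness gives it a
neighbour in `γ`. The intersection is thus covered by the neighbour sets alone, which yields the
factor `Δ` instead of `Δ + 1`. -/
theorem IsAnimal.card_inter_nbhd_le {Δ : ℕ} (hΔ : ∀ v : V, (nbrs G v).card ≤ Δ)
    {v : V} {γ U : Finset V} (h : IsAnimal G v γ) (hv : v ∉ U) :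
    (U ∩ nbhd G γ).card ≤ Δ * γ.card := by
  classical
  have hsub : U ∩ nbhd G γ ⊆ γ.biUnion (nbrs G) := by
    intro u hu
    obtain ⟨huU, hu⟩ := mem_inter.1 hu
    have huv : u ≠ v := fun e => hv (e ▸ huU)
    simp only [nbhd, mem_filter, mem_univ, true_and] at hu
    have : ∃ a ∈ γ, G.Adj a u := hu.elim (fun hu => h.exists_adj hu huv) id
    obtain ⟨a, ha, hau⟩ := this
    exact mem_biUnion.2 ⟨a, ha, by simpa [nbrs] using hau⟩
  rw [mul_comm]
  exact (card_le_card hsub).trans (card_biUnion_le_card_mul _ _ _ fun a _ => hΔ a)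

theorem IsAnimal.card_pos {v : V} {γ : Finset V} (h : IsAnimal G v γ) : 1 ≤ γ.card :=
  Finset.card_pos.2 ⟨v, h.1⟩

theorem isAnimal_of_mem {v : V} {U γ : Finset V} (h : γ ∈ animals G v U) : IsAnimal G v γ := by
  classical
  exact (mem_filter.1 h).2

theorem mem_animals {v : V} {U γ : Finset V} :
    γ ∈ animals G v U ↔ γ ⊆ insert v U ∧ IsAnimal G v γ := by
  classical
  simp [animals]

/-- Weighted count of the connected sets containing a vertex. -/
theorem sum_animals_le {Δ : ℕ} (hΔ : ∀ v : V, (nbrs G v).card ≤ Δ) {y : ℝ} (hy : 0 ≤ y)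
    {v : V} {U : Finset V} (hv : v ∉ U) :
    ∑ γ ∈ animals G v U, (y / (1 + y) ^ Δ) ^ γ.card ≤ y := by
  -- For the weight `y^|S|` the partition function is `(1 + y)^|U|`, so the expansion is an exact
  -- identity summing over connected sets. Dividing by `(1 + y)^|U|` costs at most `(1 + y)^Δ` per
  -- vertex of `γ`.
  have key := Z_insert (factorizes_pow_card (G := G) y) hv
  simp only [Z_pow_card, card_insert_of_notMem hv] at key
  have hpos : 0 < (1 + y) ^ U.card := by positivity
  refine le_of_mul_le_mul_right ?_ hpos
  have h2 : y * (1 + y) ^ U.card =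
      ∑ γ ∈ animals G v U, y ^ γ.card * (1 + y) ^ (U \ nbhd G γ).card := by
    rw [pow_succ] at key
    linarith
  rw [h2, sum_mul]
  refine sum_le_sum fun γ hγ => ?_
  have hc := (isAnimal_of_mem hγ).card_inter_nbhd_le hΔ hv
  rw [← card_sdiff_add_card_inter U (nbhd G γ), pow_add, div_pow, ← pow_mul]
  have h3 : (1 + y) ^ (U ∩ nbhd G γ).card ≤ (1 + y) ^ (Δ * γ.card) :=
    pow_le_pow_right₀ (by linarith) hc
  have h4 : 0 < (1 + y) ^ (Δ * γ.card) := by positivity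
  rw [div_mul_eq_mul_div, div_le_iff₀ h4]
  have h5 : 0 ≤ y ^ γ.card * (1 + y) ^ (U \ nbhd G γ).card := by positivity
  nlinarith [mul_le_mul_of_nonneg_left h3 h5]

/-- Vertices are removed one at a time; only those in `U ∩ W` change anything, each at the price
`lam`. -/
theorem Z_sdiff_le {f : Finset V → ℝ} {U : Finset V} {lam : ℝ} (hl : 1 ≤ lam)
    (h : ∀ T ⊆ U, ∀ u ∈ T, Z f (T.erase u) ≤ lam * Z f T) (W : Finset V) :
    Z f (U \ W) ≤ lam ^ (U ∩ W).card * Z f U := by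
  induction W using Finset.induction_on with
  | empty => simp
  | insert a W ha ih =>
    by_cases haU : a ∈ U
    · have e1 : U \ insert a W = (U \ W).erase a := by
        rw [sdiff_insert]
      have e2 : (U ∩ insert a W).card = (U ∩ W).card + 1 := by
        rw [inter_insert_of_mem haU, card_insert_of_notMem]
        simp [ha]
      rw [e1, e2, pow_succ]
      have := h (U \ W) sdiff_subset a (mem_sdiff.2 ⟨haU, ha⟩)
      have h3 := mul_le_mul_of_nonneg_left ih (by linarith : (0 : ℝ) ≤ lam)
      nlinarith
    · rw [inter_insert_of_notMem haU, sdiff_insert_of_notMem haU]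
      exact ih

/-! ### Convergence: positivity and one-vertex ratios -/

/-- Parameters for which the expansion converges: `f` is bounded by `w ^ |S|`, and `w` is small. -/
structure Regime (G : SimpleGraph V) (f : Finset V → ℝ) (Δ : ℕ) (w ε : ℝ) : Prop where
  factorizes : Factorizes G f
  bound : ∀ S, |f S| ≤ w ^ S.card
  nbrs_card_le : ∀ v : V, (nbrs G v).card ≤ Δ
  w_nonneg : 0 ≤ w
  eps_pos : 0 < ε
  eps_lt : ε < 1
  small : w * ((1 - ε)⁻¹) ^ Δ ≤ ε / (1 + ε) ^ Δ

section Regime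

variable {f : Finset V → ℝ} {Δ : ℕ} {w ε : ℝ}

theorem Regime.one_le_inv (h : Regime G f Δ w ε) : 1 ≤ (1 - ε)⁻¹ :=
  (one_le_inv₀ (by linarith [h.eps_lt])).2 (by linarith [h.eps_pos])

/-- Inductive step of the convergence proof. Deleting the neighbourhood of `γ` costs `(1 - ε)⁻¹` per
vertex, so the term of `γ` is at most `(w (1 - ε)⁻^Δ)^|γ| Z(U)`. The condition `small` puts this
below the weighted count of connected sets at `y = ε`, whose sum is at most `ε`. -/
theorem Regime.abs_sum_le (h : Regime G f Δ w ε) {v : V} {U : Finset V} (hv : v ∉ U)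
    (hpos : ∀ T ⊆ U, 0 < Z f T)
    (hle : ∀ T ⊆ U, ∀ u ∈ T, Z f (T.erase u) ≤ (1 - ε)⁻¹ * Z f T) :
    |Z f (insert v U) - Z f U| ≤ ε * Z f U := by
  rw [Z_insert h.factorizes hv, add_sub_cancel_left]
  have hl := h.one_le_inv
  have hZ := hpos U subset_rfl
  calc |∑ γ ∈ animals G v U, f γ * Z f (U \ nbhd G γ)|
      ≤ ∑ γ ∈ animals G v U, |f γ * Z f (U \ nbhd G γ)| := abs_sum_le_sum_abs _ _
    _ ≤ ∑ γ ∈ animals G v U, (ε / (1 + ε) ^ Δ) ^ γ.card * Z f U := by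
        refine sum_le_sum fun γ hγ => ?_
        rw [abs_mul, abs_of_pos (hpos _ sdiff_subset)]
        have h1 := Z_sdiff_le hl hle (nbhd G γ)
        have h2 : ((1 - ε)⁻¹) ^ (U ∩ nbhd G γ).card ≤ (((1 - ε)⁻¹) ^ Δ) ^ γ.card := by
          rw [← pow_mul]
          exact pow_le_pow_right₀ hl
            ((isAnimal_of_mem hγ).card_inter_nbhd_le h.nbrs_card_le hv)
        have hw := h.w_nonneg
        calc |f γ| * Z f (U \ nbhd G γ)
            ≤ w ^ γ.card * ((((1 - ε)⁻¹) ^ Δ) ^ γ.card * Z f U) := by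
              refine mul_le_mul (h.bound γ) (h1.trans ?_) (hpos _ sdiff_subset).le (by positivity)
              exact mul_le_mul_of_nonneg_right h2 hZ.le
          _ = (w * ((1 - ε)⁻¹) ^ Δ) ^ γ.card * Z f U := by rw [mul_pow]; ring
          _ ≤ _ := by
              refine mul_le_mul_of_nonneg_right ?_ hZ.le
              exact pow_le_pow_left₀ (by positivity) h.small _
    _ ≤ ε * Z f U := by
        rw [← sum_mul]
        exact mul_le_mul_of_nonneg_right (sum_animals_le h.nbrs_card_le h.eps_pos.le hv) hZ.le

theorem Regime.pos_and_erase_le (h : Regime G f Δ w ε) (U : Finset V) :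
    0 < Z f U ∧ ∀ u ∈ U, Z f (U.erase u) ≤ (1 - ε)⁻¹ * Z f U := by
  induction U using Finset.strongInduction with
  | H U ih =>
    have key : ∀ u ∈ U, 0 < Z f (U.erase u) ∧ (1 - ε) * Z f (U.erase u) ≤ Z f U := by
      intro u hu
      have hss := erase_ssubset hu
      have h1 := h.abs_sum_le (notMem_erase u U)
        (fun T hT => (ih T (hT.trans_ssubset hss)).1)
        (fun T hT => (ih T (hT.trans_ssubset hss)).2)
      rw [insert_erase hu] at h1
      refine ⟨(ih _ hss).1, ?_⟩
      have := (abs_le.1 h1).1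
      linarith
    have hε : 0 < 1 - ε := by linarith [h.eps_lt]
    refine ⟨?_, fun u hu => ?_⟩
    · rcases U.eq_empty_or_nonempty with rfl | ⟨u, hu⟩
      · simp [Z, h.factorizes.empty]
      · obtain ⟨h1, h2⟩ := key u hu
        have := mul_pos hε h1
        linarith
    · rw [inv_mul_eq_div, le_div_iff₀ hε, mul_comm]
      exact (key u hu).2

theorem Regime.Z_pos (h : Regime G f Δ w ε) (U : Finset V) : 0 < Z f U :=
  (h.pos_and_erase_le U).1

theorem Regime.Z_le (h : Regime G f Δ w ε) {v : V} {U : Finset V} (hv : v ∉ U) :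
    Z f U ≤ (1 - ε)⁻¹ * Z f (insert v U) := by
  have := (h.pos_and_erase_le (insert v U)).2 v (mem_insert_self _ _)
  rwa [erase_insert hv] at this

theorem Regime.Z_sdiff_div_le (h : Regime G f Δ w ε) (U W : Finset V) :
    Z f (U \ W) / Z f U ≤ ((1 - ε)⁻¹) ^ (U ∩ W).card := by
  rw [div_le_iff₀ (h.Z_pos U)]
  exact Z_sdiff_le h.one_le_inv (fun T _ => (h.pos_and_erase_le T).2) W

/-- The effect on the partition function of adding a vertex. -/
noncomputable def ratio (f : Finset V → ℝ) (v : V) (U : Finset V) : ℝ := Z f (insert v U) / Z f U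

theorem Regime.ratio_pos (h : Regime G f Δ w ε) (v : V) (U : Finset V) : 0 < ratio f v U :=
  div_pos (h.Z_pos _) (h.Z_pos _)

theorem Regime.inv_ratio_le (h : Regime G f Δ w ε) {v : V} {U : Finset V} (hv : v ∉ U) :
    (ratio f v U)⁻¹ ≤ (1 - ε)⁻¹ := by
  rw [ratio, inv_div, div_le_iff₀ (h.Z_pos _)]
  exact h.Z_le hv

/-! ### Decay of the influence of distant vertices on a ratio -/

variable (G) in
/-- `U` and `U'` have the same elements at distance less than `m` from `v`. -/
def AgreeNear (m : ℕ) (v : V) (U U' : Finset V) : Prop :=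
  ∀ u, G.edist v u < m → (u ∈ U ↔ u ∈ U')

theorem AgreeNear.sdiff {m : ℕ} {v : V} {U U' : Finset V} (h : AgreeNear G m v U U')
    (W : Finset V) : AgreeNear G m v (U \ W) (U' \ W) := by
  intro u hu
  rw [mem_sdiff, mem_sdiff, h u hu]

theorem AgreeNear.of_edist_le {m s : ℕ} {v x : V} {U U' : Finset V} (h : AgreeNear G m v U U')
    (hx : G.edist v x ≤ s) (hs : s ≤ m) : AgreeNear G (m - s) x U U' := by
  intro u hu
  apply h
  calc G.edist v u ≤ G.edist v x + G.edist x u := SimpleGraph.edist_triangle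
    _ < (s : ℕ∞) + ((m - s : ℕ) : ℕ∞) := by
        refine lt_of_le_of_lt (add_le_add_left hx _) ?_
        exact (ENat.add_lt_add_iff_left (ENat.natCast_ne_top s)).2 hu
    _ = m := by
        rw [← Nat.cast_add, Nat.add_sub_cancel' hs]

/-- A simple path inside `γ` has at most `|γ|` vertices, hence fewer than `|γ|` edges. -/
theorem IsAnimal.edist_lt {v u : V} {γ : Finset V} (h : IsAnimal G v γ) (hu : u ∈ γ) :
    G.edist v u < γ.card := by
  classical
  obtain ⟨p, hp⟩ := (h.2 u hu).exists_isPath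
  have hsub : p.support.toFinset ⊆ γ := by
    intro a ha
    rw [List.mem_toFinset] at ha
    clear hp
    have hv := h.1
    clear h
    induction p with
    | nil => simpa using (by simpa using ha : a = _) ▸ hv
    | cons hab p ih =>
      rw [SimpleGraph.Walk.support_cons, List.mem_cons] at ha
      rcases ha with rfl | ha
      · exact hv
      · exact ih hu ha hab.2.2
  have hle := card_le_card hsub
  rw [List.toFinset_card_of_nodup hp.support_nodup, SimpleGraph.Walk.length_support] at hle
  have h1 : G.edist v u ≤ p.length := by
    have := SimpleGraph.Walk.edist_le (p.mapLe (fun _ _ hab => hab.1 : within G γ ≤ G))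
    simpa using this
  refine lt_of_le_of_lt h1 ?_
  exact_mod_cast hle

theorem IsAnimal.edist_nbhd_le {v u : V} {γ : Finset V} (h : IsAnimal G v γ)
    (hu : u ∈ nbhd G γ) : G.edist v u ≤ γ.card := by
  classical
  simp only [nbhd, mem_filter, mem_univ, true_and] at hu
  rcases hu with hu | ⟨a, ha, hau⟩
  · exact (h.edist_lt hu).le
  · calc G.edist v u ≤ G.edist v a + G.edist a u := SimpleGraph.edist_triangle
      _ = G.edist v a + 1 := by rw [SimpleGraph.edist_eq_one_iff_adj.2 hau]
      _ ≤ γ.card := Order.add_one_le_of_lt (h.edist_lt ha)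

theorem abs_inv_sub_inv_le {a b l : ℝ} (ha : 0 < a) (hb : 0 < b) (hal : a⁻¹ ≤ l) (hbl : b⁻¹ ≤ l) :
    |a⁻¹ - b⁻¹| ≤ l ^ 2 * |a - b| := by
  have e : a⁻¹ - b⁻¹ = a⁻¹ * b⁻¹ * (b - a) := by field_simp
  have h1 : 0 < a⁻¹ := inv_pos.2 ha
  have h2 : 0 < b⁻¹ := inv_pos.2 hb
  rw [e, abs_mul, abs_of_pos (mul_pos h1 h2), abs_sub_comm]
  refine mul_le_mul_of_nonneg_right ?_ (abs_nonneg _)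
  rw [sq]
  exact mul_le_mul hal hbl h2.le (h1.le.trans hal)

/-- The quotient is a product of inverse one-vertex ratios, one for each vertex of `W`. Swapping `U`
for `U'` in one factor at a time costs `(1 - ε)⁻² δ` for that factor and `(1 - ε)⁻¹` for each other
one. -/
theorem Regime.abs_sdiff_sub_le (h : Regime G f Δ w ε) {k : ℕ} {δ : ℝ} (hδ : 0 ≤ δ)
    {U U' : Finset V} (W : Finset V)
    (hr : ∀ u Y Y', u ∉ Y → u ∉ Y' → AgreeNear G k u Y Y' → |ratio f u Y - ratio f u Y'| ≤ δ)
    (hU : W ⊆ U) (hU' : W ⊆ U') (hW : ∀ u ∈ W, AgreeNear G k u U U') :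
    |Z f (U \ W) / Z f U - Z f (U' \ W) / Z f U'| ≤
      W.card * ((1 - ε)⁻¹) ^ (W.card + 1) * δ := by
  induction W using Finset.induction_on with
  | empty => simp [(h.Z_pos U).ne', (h.Z_pos U').ne']
  | insert a W ha ih =>
    have ih := ih ((subset_insert _ _).trans hU) ((subset_insert _ _).trans hU')
      (fun u hu => hW u (mem_insert_of_mem hu))
    have step : ∀ X : Finset V, insert a W ⊆ X →
        Z f (X \ insert a W) / Z f X =
          Z f (X \ W) / Z f X * (ratio f a (X \ insert a W))⁻¹ := by
      intro X hX
      have e : insert a (X \ insert a W) = X \ W := by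
        rw [sdiff_insert, insert_erase]
        exact mem_sdiff.2 ⟨hX (mem_insert_self _ _), ha⟩
      rw [ratio, e, inv_div, div_mul_div_comm, mul_comm (Z f X), mul_div_mul_left]
      exact (h.Z_pos _).ne'
    rw [step U hU, step U' hU', card_insert_of_notMem ha]
    have hnot : ∀ X : Finset V, a ∉ X \ insert a W := fun X => by simp
    have h1 := h.inv_ratio_le (hnot U)
    have h2 := h.inv_ratio_le (hnot U')
    have h3 := abs_inv_sub_inv_le (h.ratio_pos a _) (h.ratio_pos a _) h1 h2
    have h4 := hr a _ _ (hnot U) (hnot U') ((hW a (mem_insert_self _ _)).sdiff (insert a W))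
    have h5 := h.Z_sdiff_div_le U' W
    rw [inter_eq_right.2 ((subset_insert _ _).trans hU')] at h5
    have hl := h.one_le_inv
    generalize (1 - ε)⁻¹ = l at *
    have p1 : 0 ≤ (ratio f a (U \ insert a W))⁻¹ := (inv_pos.2 (h.ratio_pos a _)).le
    have p2 : 0 ≤ Z f (U' \ W) / Z f U' := (div_pos (h.Z_pos _) (h.Z_pos _)).le
    generalize (ratio f a (U \ insert a W))⁻¹ = b at *
    generalize (ratio f a (U' \ insert a W))⁻¹ = b' at *
    generalize Z f (U \ W) / Z f U = A at *
    generalize Z f (U' \ W) / Z f U' = A' at *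
    have h6 : |b - b'| ≤ l ^ 2 * δ := h3.trans (mul_le_mul_of_nonneg_left h4 (by positivity))
    calc |A * b - A' * b'| = |(A - A') * b + A' * (b - b')| := by congr 1; ring
      _ ≤ |A - A'| * b + A' * |b - b'| := by
          refine (abs_add_le _ _).trans ?_
          rw [abs_mul, abs_mul, abs_of_nonneg p1, abs_of_nonneg p2]
      _ ≤ (W.card * l ^ (W.card + 1) * δ) * l + l ^ W.card * (l ^ 2 * δ) := by
          refine add_le_add (mul_le_mul ih h1 p1 (by positivity)) ?_
          exact mul_le_mul h5 h6 (abs_nonneg _) (by positivity)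
      _ = ((W.card + 1 : ℕ) : ℝ) * l ^ (W.card + 1 + 1) * δ := by
          push_cast
          ring

theorem Regime.ratio_eq (h : Regime G f Δ w ε) {v : V} {U : Finset V} (hv : v ∉ U) :
    ratio f v U = 1 + ∑ γ ∈ animals G v U, f γ * (Z f (U \ nbhd G γ) / Z f U) := by
  rw [ratio, Z_insert h.factorizes hv, add_div, div_self (h.Z_pos U).ne', sum_div]
  simp only [mul_div_assoc]

theorem Regime.weight_mul_le (h : Regime G f Δ w ε) {v : V} {U : Finset V} (hv : v ∉ U)
    {γ : Finset V} (hγ : γ ∈ animals G v U) :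
    |f γ * (Z f (U \ nbhd G γ) / Z f U)| ≤ (w * ((1 - ε)⁻¹) ^ Δ) ^ γ.card := by
  have hp : 0 < Z f (U \ nbhd G γ) / Z f U := div_pos (h.Z_pos _) (h.Z_pos _)
  rw [abs_mul, abs_of_pos hp, mul_pow, ← pow_mul]
  refine mul_le_mul (h.bound γ) ((h.Z_sdiff_div_le U _).trans ?_) hp.le (pow_nonneg h.w_nonneg _)
  exact pow_le_pow_right₀ h.one_le_inv
    ((isAnimal_of_mem hγ).card_inter_nbhd_le h.nbrs_card_le hv)

theorem nat_mul_half_pow_le {s : ℕ} (hs : 1 ≤ s) : (s : ℝ) * (1 / 2) ^ s ≤ 1 / 2 := by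
  obtain ⟨t, rfl⟩ := Nat.exists_eq_add_of_le' hs
  have h1 : ((t + 1 : ℕ) : ℝ) ≤ 2 ^ t := by exact_mod_cast Nat.lt_two_pow_self
  have h2 : (2 : ℝ) ^ t * (1 / 2) ^ t = 1 := by rw [← mul_pow]; norm_num
  have h3 : (0 : ℝ) < (1 / 2) ^ t := by positivity
  rw [pow_succ]
  nlinarith

set_option maxHeartbeats 1000000 in
/-- The effect of adding a vertex depends little on what happens far away. -/
theorem Regime.abs_ratio_sub_le (h : Regime G f Δ w ε) {θ : ℝ} (hΔ : 1 ≤ Δ) (hθ : 0 < θ)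
    (hθ1 : θ ≤ 1) (hl : (1 - ε)⁻¹ ≤ 8 / 7)
    (hdec : w * ((1 - ε)⁻¹) ^ Δ ≤ θ / 2 * ((Δ : ℝ)⁻¹ / (1 + (Δ : ℝ)⁻¹) ^ Δ)) (m : ℕ) :
    ∀ v U U', v ∉ U → v ∉ U' → AgreeNear G m v U U' →
      |ratio f v U - ratio f v U'| ≤ 3 * θ ^ m := by
  classical
  induction m using Nat.strong_induction_on with
  | _ m ih =>
  intro v U U' hv hv' hag
  have hΔ0 : (0 : ℝ) < Δ := by exact_mod_cast hΔ
  have hy : (0 : ℝ) ≤ (Δ : ℝ)⁻¹ := by positivity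
  have hy1 : (Δ : ℝ)⁻¹ ≤ 1 := inv_le_one_of_one_le₀ (by exact_mod_cast hΔ)
  have hsum : ∀ X, v ∉ X → ∀ (p : Finset V → Prop) [DecidablePred p],
      ∑ γ ∈ (animals G v X).filter p, ((Δ : ℝ)⁻¹ / (1 + (Δ : ℝ)⁻¹) ^ Δ) ^ γ.card ≤ (Δ : ℝ)⁻¹ := by
    intro X hX p _
    refine le_trans (sum_le_sum_of_subset_of_nonneg (filter_subset _ _) ?_)
      (sum_animals_le h.nbrs_card_le hy hX)
    intros
    positivity
  have hb0 : 0 ≤ (Δ : ℝ)⁻¹ / (1 + (Δ : ℝ)⁻¹) ^ Δ := by positivity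
  generalize hb : (Δ : ℝ)⁻¹ / (1 + (Δ : ℝ)⁻¹) ^ Δ = b at *
  set l := (1 - ε)⁻¹ with hldef
  have hl1 : 1 ≤ l := h.one_le_inv
  have hw := h.w_nonneg
  -- The three factors have separate tasks: `θ^s` pays for distance, `2^(-s)` absorbs a factor `s`
  -- in the near terms, and `b^s` is summable over connected sets with total at most `Δ⁻¹`.
  have hpow : ∀ s : ℕ, (w * l ^ Δ) ^ s ≤ θ ^ s * ((1 / 2) ^ s * b ^ s) := by
    intro s
    rw [← mul_pow, ← mul_pow]
    exact pow_le_pow_left₀ (by positivity) (hdec.trans_eq (by ring)) s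
  -- Connected sets with at least `m` vertices already carry `θ^m`, so no comparison between `U` and
  -- `U'` is needed for them.
  have hfar : ∀ X, v ∉ X →
      |∑ γ ∈ (animals G v X).filter (fun γ => ¬ γ.card < m),
        f γ * (Z f (X \ nbhd G γ) / Z f X)| ≤ θ ^ m * (1 / 2) := by
    intro X hX
    calc _ ≤ ∑ γ ∈ (animals G v X).filter (fun γ => ¬ γ.card < m),
          θ ^ m * (1 / 2) * b ^ γ.card := by
          refine (abs_sum_le_sum_abs _ _).trans (sum_le_sum fun γ hγ => ?_)
          obtain ⟨hγ, hm⟩ := mem_filter.1 hγ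
          refine (h.weight_mul_le hX hγ).trans ((hpow _).trans ?_)
          rw [mul_assoc]
          have hs := (isAnimal_of_mem hγ).card_pos
          have e1 : θ ^ γ.card ≤ θ ^ m := pow_le_pow_of_le_one hθ.le hθ1 (not_lt.1 hm)
          have e2 : ((1 : ℝ) / 2) ^ γ.card ≤ 1 / 2 := by
            simpa using pow_le_pow_of_le_one (by norm_num : (0 : ℝ) ≤ 1 / 2) (by norm_num) hs
          exact mul_le_mul e1 (mul_le_mul_of_nonneg_right e2 (by positivity)) (by positivity)
            (by positivity)
      _ ≤ θ ^ m * (1 / 2) * 1 := by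
          rw [← mul_sum]
          exact mul_le_mul_of_nonneg_left ((hsum X hX _).trans hy1) (by positivity)
      _ = _ := mul_one _
  -- Connected sets with fewer than `m` vertices stay where `U` and `U'` agree.
  have hsame : (animals G v U).filter (fun γ => γ.card < m) =
      (animals G v U').filter (fun γ => γ.card < m) := by
    have aux : ∀ X X', AgreeNear G m v X X' → ∀ γ, γ ∈ animals G v X → γ.card < m →
        γ ∈ animals G v X' := by
      intro X X' hX γ hγ hm
      rw [mem_animals] at hγ ⊢
      refine ⟨fun u hu => ?_, hγ.2⟩
      rcases mem_insert.1 (hγ.1 hu) with e | hu'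
      · exact e ▸ mem_insert_self _ _
      · refine mem_insert_of_mem ((hX u ?_).1 hu')
        exact (hγ.2.edist_lt hu).trans (by exact_mod_cast hm)
    ext γ
    simp only [mem_filter]
    exact ⟨fun hγ => ⟨aux U U' hag γ hγ.1 hγ.2, hγ.2⟩,
      fun hγ => ⟨aux U' U (fun u hu => (hag u hu).symm) γ hγ.1 hγ.2, hγ.2⟩⟩
  -- The neighbourhood of `γ` lies within distance `|γ|` of `v`, so around its vertices `U` and `U'`
  -- still agree up to distance `m - |γ|`. Since `|γ| ≥ 1`, the induction hypothesis applies with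
  -- `θ^(m - |γ|)`, and `θ^|γ|` from the weight restores `θ^m`. The factor `Δ` from the number of
  -- removed vertices is cancelled by the total `Δ⁻¹` of the count.
  have hnear : |∑ γ ∈ (animals G v U).filter (fun γ => γ.card < m),
        (f γ * (Z f (U \ nbhd G γ) / Z f U) - f γ * (Z f (U' \ nbhd G γ) / Z f U'))| ≤
      θ ^ m * (12 / 7) := by
    calc _ ≤ ∑ γ ∈ (animals G v U).filter (fun γ => γ.card < m),
          θ ^ m * (12 / 7) * Δ * b ^ γ.card := by
          refine (abs_sum_le_sum_abs _ _).trans (sum_le_sum fun γ hγ => ?_)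
          obtain ⟨hγ, hm⟩ := mem_filter.1 hγ
          have han := isAnimal_of_mem hγ
          have hs := han.card_pos
          have hN : U' ∩ nbhd G γ = U ∩ nbhd G γ := by
            ext u
            simp only [mem_inter]
            refine and_congr_left fun hu => (hag u ?_).symm
            exact (han.edist_nbhd_le hu).trans_lt (by exact_mod_cast hm)
          have h1 := h.abs_sdiff_sub_le (k := m - γ.card) (δ := 3 * θ ^ (m - γ.card))
            (by positivity) (U := U) (U' := U') (U ∩ nbhd G γ) (ih _ (by omega))
            inter_subset_left (hN ▸ inter_subset_left)
            (fun u hu => hag.of_edist_le (han.edist_nbhd_le (mem_inter.1 hu).2) hm.le)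
          rw [sdiff_inter_self_left, ← hN, sdiff_inter_self_left, hN, ← hldef] at h1
          have hc := han.card_inter_nbhd_le h.nbrs_card_le hv
          have hlp : l ^ ((U ∩ nbhd G γ).card + 1) ≤ (l ^ Δ) ^ γ.card * (8 / 7) := by
            rw [pow_succ, ← pow_mul]
            exact mul_le_mul (pow_le_pow_right₀ hl1 hc) hl (by positivity) (by positivity)
          have hcr : ((U ∩ nbhd G γ).card : ℝ) ≤ Δ * γ.card := by exact_mod_cast hc
          rw [← mul_sub, abs_mul]
          calc _ ≤ w ^ γ.card * ((Δ * γ.card) * ((l ^ Δ) ^ γ.card * (8 / 7)) *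
                (3 * θ ^ (m - γ.card))) := by
                refine mul_le_mul (h.bound γ) (h1.trans ?_) (abs_nonneg _) (by positivity)
                refine mul_le_mul_of_nonneg_right ?_ (by positivity)
                exact mul_le_mul hcr hlp (by positivity) (by positivity)
            _ = (w * l ^ Δ) ^ γ.card * (θ ^ (m - γ.card) * (24 / 7) * Δ * γ.card) := by
                rw [mul_pow]; ring
            _ ≤ θ ^ γ.card * ((1 / 2) ^ γ.card * b ^ γ.card) *
                (θ ^ (m - γ.card) * (24 / 7) * Δ * γ.card) :=
                mul_le_mul_of_nonneg_right (hpow _) (by positivity)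
            _ = θ ^ m * (24 / 7) * Δ * b ^ γ.card * (γ.card * (1 / 2) ^ γ.card) := by
                rw [← Nat.sub_add_cancel hm.le, pow_add]
                simp only [Nat.add_sub_cancel]
                ring
            _ ≤ θ ^ m * (24 / 7) * Δ * b ^ γ.card * (1 / 2) :=
                mul_le_mul_of_nonneg_left (nat_mul_half_pow_le hs) (by positivity)
            _ = _ := by ring
      _ ≤ θ ^ m * (12 / 7) * Δ * (Δ : ℝ)⁻¹ := by
          rw [← mul_sum]
          exact mul_le_mul_of_nonneg_left (hsum U hv _) (by positivity)
      _ = _ := by field_simp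
  rw [h.ratio_eq hv, h.ratio_eq hv',
    ← sum_filter_add_sum_filter_not (animals G v U) (fun γ => γ.card < m),
    ← sum_filter_add_sum_filter_not (animals G v U') (fun γ => γ.card < m), ← hsame]
  rw [sum_sub_distrib] at hnear
  have h1 := abs_le.1 hnear
  have h2 := abs_le.1 (hfar U hv)
  have h3 := abs_le.1 (hfar U' hv')
  have h4 : 0 < θ ^ m := by positivity
  rw [abs_le]
  -- The near part and the two far parts add up to `12/7 + 1/2 + 1/2 = 19/7 ≤ 3`.
  constructor <;> linarith [h1.1, h1.2, h2.1, h2.2, h3.1, h3.2]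

/-! ### Mixed differences of the logarithm of the partition function -/

theorem log_sub_log_le {a b l : ℝ} (ha : 0 < a) (hb : 0 < b) (hbl : b⁻¹ ≤ l) :
    Real.log a - Real.log b ≤ l * |a - b| := by
  rw [← Real.log_div ha.ne' hb.ne']
  refine (Real.log_le_sub_one_of_pos (div_pos ha hb)).trans ?_
  have e : a / b - 1 = b⁻¹ * (a - b) := by field_simp
  rw [e]
  exact (mul_le_mul_of_nonneg_left (le_abs_self _) (inv_pos.2 hb).le).trans
    (mul_le_mul_of_nonneg_right hbl (abs_nonneg _))

/-- The effect of deleting `D` is a sum of log-ratios, one for each vertex of `D` that is present.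
Each is compared between the two environments, and the lower bound on ratios makes the logarithm
Lipschitz there. -/
theorem Regime.abs_log_sub_le (h : Regime G f Δ w ε) {m : ℕ} {δ : ℝ}
    (hr : ∀ u Y Y', u ∉ Y → u ∉ Y' → AgreeNear G m u Y Y' → |ratio f u Y - ratio f u Y'| ≤ δ)
    {U U' : Finset V} (D : Finset V) (hD : ∀ v ∈ D, v ∈ U ↔ v ∈ U')
    (hag : ∀ v ∈ D, AgreeNear G m v U U') :
    |(Real.log (Z f U) - Real.log (Z f (U \ D))) -
      (Real.log (Z f U') - Real.log (Z f (U' \ D)))| ≤ D.card * ((1 - ε)⁻¹ * δ) := by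
  have hl := h.one_le_inv
  induction D using Finset.induction_on with
  | empty => simp
  | insert a D ha ih =>
    have ih := ih (fun v hv => hD v (mem_insert_of_mem hv))
      (fun v hv => hag v (mem_insert_of_mem hv))
    rw [card_insert_of_notMem ha]
    push_cast
    have hδ : 0 ≤ (1 - ε)⁻¹ * δ := by
      have := hr a ∅ ∅ (notMem_empty a) (notMem_empty a) (fun u _ => Iff.rfl)
      exact mul_nonneg (by linarith) ((abs_nonneg _).trans this)
    by_cases haU : a ∈ U
    · have haU' := (hD a (mem_insert_self _ _)).1 haU
      have step : ∀ X : Finset V, a ∈ X → Real.log (Z f (X \ insert a D)) =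
          Real.log (Z f (X \ D)) - Real.log (ratio f a (X \ insert a D)) := by
        intro X hX
        have e : insert a (X \ insert a D) = X \ D := by
          rw [sdiff_insert, insert_erase]
          exact mem_sdiff.2 ⟨hX, ha⟩
        rw [ratio, e, Real.log_div (h.Z_pos _).ne' (h.Z_pos _).ne']
        ring
      have hnot : ∀ X : Finset V, a ∉ X \ insert a D := fun X => by simp
      have h4 := hr a _ _ (hnot U) (hnot U') ((hag a (mem_insert_self _ _)).sdiff (insert a D))
      have h5 := log_sub_log_le (h.ratio_pos a (U \ insert a D)) (h.ratio_pos a (U' \ insert a D))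
        (h.inv_ratio_le (hnot U'))
      have h6 := log_sub_log_le (h.ratio_pos a (U' \ insert a D)) (h.ratio_pos a (U \ insert a D))
        (h.inv_ratio_le (hnot U))
      rw [abs_sub_comm] at h6
      have h7 := mul_le_mul_of_nonneg_left h4 (by linarith : (0 : ℝ) ≤ (1 - ε)⁻¹)
      rw [step U haU, step U' haU']
      rw [abs_le] at ih ⊢
      constructor <;> linarith [ih.1, ih.2]
    · have haU' := fun h' => haU ((hD a (mem_insert_self _ _)).2 h')
      rw [sdiff_insert_of_notMem haU, sdiff_insert_of_notMem haU']
      linarith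

/-- The clusters that join two regions contribute little if the regions are far apart. -/
theorem Regime.abs_cross_le (h : Regime G f Δ w ε) {m : ℕ} {δ : ℝ}
    (hr : ∀ u Y Y', u ∉ Y → u ∉ Y' → AgreeNear G m u Y Y' → |ratio f u Y - ratio f u Y'| ≤ δ)
    {R D a₀ a₁ y₀ y₁ : Finset V} (ha₀ : a₀ ⊆ R) (ha₁ : a₁ ⊆ R) (hy₀ : Disjoint y₀ R)
    (hy₁ : Disjoint y₁ R) (hDR : D ⊆ R) (hD : ∀ v ∈ R, v ∉ D → ∀ u ∉ R, ¬ G.Adj v u)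
    (hag : ∀ v ∈ D, AgreeNear G m v y₀ y₁) :
    |Real.log (Z f (a₁ ∪ y₁)) - Real.log (Z f (a₁ ∪ y₀)) - Real.log (Z f (a₀ ∪ y₁)) +
      Real.log (Z f (a₀ ∪ y₀))| ≤ 2 * D.card * ((1 - ε)⁻¹ * δ) := by
  -- Without `D`, nothing left in `R` touches the outside, so `log Z` is a sum of a function of `a`
  -- and a function of `y`; its mixed difference is zero.
  have hfac : ∀ a ⊆ R, ∀ y, Disjoint y R → Real.log (Z f ((a ∪ y) \ D)) =
      Real.log (Z f (a \ D)) + Real.log (Z f y) := by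
    intro a ha y hy
    have e : (a ∪ y) \ D = (a \ D) ∪ y := by
      rw [union_sdiff_distrib, sdiff_eq_self_of_disjoint (hy.mono_right hDR)]
    rw [e, Z_union h.factorizes, Real.log_mul (h.Z_pos _).ne' (h.Z_pos _).ne']
    · exact (hy.mono_right (sdiff_subset.trans ha)).symm
    · intro v hv u hu
      rw [mem_sdiff] at hv
      exact hD v (ha hv.1) hv.2 u (Finset.disjoint_left.1 hy hu)
  have hdiff : ∀ a ⊆ R, |(Real.log (Z f (a ∪ y₀)) - Real.log (Z f ((a ∪ y₀) \ D))) -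
      (Real.log (Z f (a ∪ y₁)) - Real.log (Z f ((a ∪ y₁) \ D)))| ≤
        D.card * ((1 - ε)⁻¹ * δ) := by
    intro a ha
    refine h.abs_log_sub_le hr D (fun v hv => ?_) (fun v hv u hu => ?_)
    · have h0 := Finset.disjoint_right.1 hy₀ (hDR hv)
      have h1 := Finset.disjoint_right.1 hy₁ (hDR hv)
      simp [h0, h1]
    · rw [mem_union, mem_union, hag v hv u hu]
  have h0 := hdiff a₀ ha₀
  have h1 := hdiff a₁ ha₁
  rw [hfac _ ha₀ _ hy₀, hfac _ ha₀ _ hy₁] at h0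
  rw [hfac _ ha₁ _ hy₀, hfac _ ha₁ _ hy₁] at h1
  rw [abs_le] at h0 h1 ⊢
  constructor <;> linarith [h0.1, h0.2, h1.1, h1.2]

end Regime

end PolymerGas

/-! ### Operators trivial on a qudit, and the completely depolarizing channel -/

namespace NoisyCircuit

open Matrix Function

variable {h n : ℕ}

/-- The matrix unit `|a⟩⟨b|` on qudit `i`. -/
def siteUnit (i : Fin n) (a b : Fin h) : QOp h n :=
  Matrix.of fun x y => if x i = a ∧ y = update x i b then 1 else 0

theorem update_eq_iff {x y : Fin n → Fin h} {i : Fin n} {a b : Fin h} :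
    (x i = a ∧ y = update x i b) ↔ (y i = b ∧ x = update y i a) := by
  constructor
  · rintro ⟨rfl, rfl⟩
    simp
  · rintro ⟨rfl, rfl⟩
    simp

theorem siteUnit_mul_apply (i : Fin n) (a b : Fin h) (X : QOp h n) (x y : Fin n → Fin h) :
    (siteUnit i a b * X) x y = if x i = a then X (update x i b) y else 0 := by
  rw [Matrix.mul_apply, Finset.sum_eq_single (update x i b)]
  · simp [siteUnit]
  · intro z _ hz
    simp [siteUnit, hz]
  · simp

theorem mul_siteUnit_apply (i : Fin n) (a b : Fin h) (X : QOp h n) (x y : Fin n → Fin h) :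
    (X * siteUnit i a b) x y = if y i = b then X x (update y i a) else 0 := by
  rw [Matrix.mul_apply, Finset.sum_eq_single (update y i a)]
  · by_cases hy : y i = b
    · subst hy
      simp [siteUnit]
    · simp only [siteUnit, Matrix.of_apply, update_eq_iff, hy, false_and, if_false, mul_zero]
  · intro z _ hz
    simp only [siteUnit, Matrix.of_apply, update_eq_iff, hz, and_false, if_false, mul_zero]
  · simp

theorem conjTranspose_siteUnit (i : Fin n) (a b : Fin h) :
    (siteUnit i a b : QOp h n)ᴴ = siteUnit i b a := by
  ext x y
  simp only [Matrix.conjTranspose_apply, siteUnit, Matrix.of_apply, update_eq_iff (x := y)]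
  split_ifs <;> simp

/-- `X` acts trivially on qudit `i`. -/
def Off (i : Fin n) (X : QOp h n) : Prop := ∀ a b, Commute X (siteUnit i a b)

/-- Commuting with all matrix units of a site forces the tensor factor there to be a scalar; this is
the entrywise form of that fact. -/
theorem off_iff {i : Fin n} {X : QOp h n} :
    Off i X ↔ ∀ x y b, X x y = if x i = y i then X (update x i b) (update y i b) else 0 := by
  constructor
  · intro hX x y b
    have := congrFun (congrFun (hX (y i) b).eq x) (update y i b)
    rw [mul_siteUnit_apply, siteUnit_mul_apply] at this
    simpa using this
  · intro hX a b
    ext x y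
    rw [mul_siteUnit_apply, siteUnit_mul_apply, hX x (update y i a) b, hX (update x i b) y b]
    simp only [update_self, update_idem, eq_comm (a := b)]
    split_ifs <;> rfl

theorem Off.mul {i : Fin n} {X Y : QOp h n} (hX : Off i X) (hY : Off i Y) : Off i (X * Y) :=
  fun a b => (hX a b).mul_left (hY a b)

theorem Off.sub {i : Fin n} {X Y : QOp h n} (hX : Off i X) (hY : Off i Y) : Off i (X - Y) :=
  fun a b => (hX a b).sub_left (hY a b)

theorem Off.conjTranspose {i : Fin n} {X : QOp h n} (hX : Off i X) : Off i Xᴴ := by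
  intro a b
  have := (hX b a).star_star
  rwa [star_eq_conjTranspose, star_eq_conjTranspose, conjTranspose_siteUnit] at this

/-- The completely depolarizing channel on qudit `i`. -/
noncomputable def dep (i : Fin n) : Module.End ℂ (QOp h n) :=
  (h : ℂ)⁻¹ • ∑ a : Fin h, ∑ b : Fin h,
    LinearMap.mulLeft ℂ (siteUnit i a b : QOp h n) * LinearMap.mulRight ℂ (siteUnit i b a)

theorem dep_eq (i : Fin n) (X : QOp h n) :
    dep i X = (h : ℂ)⁻¹ • ∑ a : Fin h, ∑ b : Fin h, siteUnit i a b * X * siteUnit i b a := by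
  simp [dep, LinearMap.sum_apply, mul_assoc]

theorem dep_apply (i : Fin n) (X : QOp h n) (x y : Fin n → Fin h) :
    dep i X x y = (h : ℂ)⁻¹ *
      if x i = y i then ∑ b, X (update x i b) (update y i b) else 0 := by
  rw [dep_eq, Matrix.smul_apply, Matrix.sum_apply, smul_eq_mul]
  congr 1
  simp only [Matrix.sum_apply, mul_siteUnit_apply, siteUnit_mul_apply]
  split_ifs with hxy
  · rw [Finset.sum_eq_single (x i)]
    · simp [hxy]
    · intro a _ ha
      simp [ha.symm]
    · simp
  · refine Finset.sum_eq_zero fun a _ => Finset.sum_eq_zero fun b _ => ?_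
    split_ifs with h1 h2
    · exact absurd (h2.trans h1.symm) hxy
    · rfl
    · rfl

theorem depolarize_eq (q : ℝ) (i : Fin n) (ρ : QOp h n) :
    depolarize (1 - q) i ρ = (dep i + (q : ℂ) • (1 - dep i) : Module.End ℂ (QOp h n)) ρ := by
  ext x y
  simp only [depolarize, Matrix.of_apply, LinearMap.add_apply, LinearMap.smul_apply,
    LinearMap.sub_apply, Module.End.one_apply, Matrix.add_apply, Matrix.smul_apply,
    Matrix.sub_apply, dep_apply, smul_eq_mul]
  push_cast
  ring

theorem dep_off_self (i : Fin n) (X : QOp h n) : Off i (dep i X) := by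
  rw [off_iff]
  intro x y b
  simp only [dep_apply, update_self, update_idem]
  split_ifs <;> simp

theorem Off.dep {i : Fin n} {X : QOp h n} (hX : Off i X) (k : Fin n) : Off i (dep k X) := by
  by_cases hik : i = k
  · exact hik ▸ dep_off_self i X
  rw [off_iff] at hX ⊢
  intro x y b
  simp only [dep_apply]
  rw [update_of_ne (Ne.symm hik), update_of_ne (Ne.symm hik)]
  have e : ∀ c, X (update x k c) (update y k c) =
      if x i = y i then X (update (update x i b) k c) (update (update y i b) k c) else 0 := by
    intro c
    rw [hX _ _ b, update_of_ne hik, update_of_ne hik, update_comm hik, update_comm hik]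
  by_cases hi : x i = y i
  · simp only [e, if_pos hi]
  · simp only [e, if_neg hi, Finset.sum_const_zero, ite_self, mul_zero]

/-- An operator trivial on `i` commutes with the Kraus operators and can be pulled out. Together
with the right-handed version this makes `dep i` a conditional expectation. -/
theorem dep_mul_left {i : Fin n} {X Y : QOp h n} (hY : Off i Y) :
    dep i (X * Y) = dep i X * Y := by
  simp only [dep_eq, smul_mul_assoc, Finset.sum_mul]
  refine congrArg _ ?_
  refine Finset.sum_congr rfl fun a _ => Finset.sum_congr rfl fun b _ => ?_
  rw [mul_assoc, mul_assoc X, (hY b a).eq]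
  simp only [mul_assoc]

theorem dep_mul_right {i : Fin n} {X Y : QOp h n} (hX : Off i X) :
    dep i (X * Y) = X * dep i Y := by
  simp only [dep_eq, mul_smul_comm, Finset.mul_sum]
  refine congrArg _ ?_
  refine Finset.sum_congr rfl fun a _ => Finset.sum_congr rfl fun b _ => ?_
  simp only [← mul_assoc]
  rw [← (hX a b).eq]

theorem dep_of_off [NeZero h] {i : Fin n} {X : QOp h n} (hX : Off i X) : dep i X = X := by
  have hh : (h : ℂ) ≠ 0 := by exact_mod_cast NeZero.ne h
  ext x y
  rw [off_iff] at hX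
  rw [dep_apply]
  by_cases hxy : x i = y i
  · have : ∀ b, X (update x i b) (update y i b) = X x y := by
      intro b
      rw [hX x y b, if_pos hxy]
    simp [this, hxy, hh]
  · rw [hX x y (x i)]
    simp [hxy]

theorem trace_mul_dep (i : Fin n) (X Y : QOp h n) :
    trace (X * dep i Y) = trace (dep i X * Y) := by
  simp only [dep_eq, Matrix.mul_smul, Matrix.smul_mul, Matrix.trace_smul, Finset.mul_sum,
    Finset.sum_mul, Matrix.trace_sum]
  congr 1
  rw [Finset.sum_comm]
  refine Finset.sum_congr rfl fun a _ => Finset.sum_congr rfl fun b _ => ?_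
  rw [← mul_assoc, trace_mul_comm]
  simp only [mul_assoc]

open ComplexOrder in
theorem dep_posSemidef (i : Fin n) {X : QOp h n} (hX : X.PosSemidef) : (dep i X).PosSemidef := by
  rw [dep_eq]
  refine PosSemidef.smul ?_ (by positivity)
  refine posSemidef_sum _ fun a _ => posSemidef_sum _ fun b _ => ?_
  have := hX.mul_mul_conjTranspose_same (siteUnit i a b)
  rwa [conjTranspose_siteUnit] at this

theorem off_one (i : Fin n) : Off i (1 : QOp h n) := fun _ _ => Commute.one_left _

/-! ### Gates on blocks and the unitary of a layer -/

/-- The operator `M` on the qudits of `b`, as an operator on all qudits. -/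
def embed (b : Finset (Fin n)) (M : Matrix (b → Fin h) (b → Fin h) ℂ) : QOp h n :=
  Matrix.of fun x y => if ∀ i, i ∉ b → x i = y i then M (fun i => x i) (fun i => y i) else 0

theorem off_piecewise {b : Finset (Fin n)} {X : QOp h n} (hX : ∀ i ∈ b, Off i X)
    (x y z : Fin n → Fin h) :
    X x y = if ∀ i ∈ b, x i = y i then X (b.piecewise z x) (b.piecewise z y) else 0 := by
  induction b using Finset.induction_on with
  | empty => simp
  | insert a b ha ih =>
    rw [ih fun i hi => hX i (Finset.mem_insert_of_mem hi),
      off_iff.1 (hX a (Finset.mem_insert_self _ _)) _ _ (z a), Finset.piecewise_insert,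
      Finset.piecewise_insert, Finset.piecewise_eq_of_notMem _ _ _ ha,
      Finset.piecewise_eq_of_notMem _ _ _ ha]
    simp only [Finset.forall_mem_insert]
    split_ifs <;> tauto

/-- Each matrix product has a single surviving intermediate configuration: triviality of `X` on `b`
fixes its values on `b`, and the embedded operator fixes them elsewhere. -/
theorem commute_embed {b : Finset (Fin n)} {X : QOp h n} (hX : ∀ i ∈ b, Off i X)
    (M : Matrix (b → Fin h) (b → Fin h) ℂ) : Commute X (embed b M) := by
  ext x y
  rw [Matrix.mul_apply, Matrix.mul_apply, Finset.sum_eq_single (b.piecewise x y),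
    Finset.sum_eq_single (b.piecewise y x)]
  · have e1 : embed b M (b.piecewise x y) y = M (fun i => x i) (fun i => y i) := by
      rw [embed, Matrix.of_apply, if_pos]
      · congr 1
        ext i
        simp
      · intro i hi
        simp [hi]
    have e2 : embed b M x (b.piecewise y x) = M (fun i => x i) (fun i => y i) := by
      rw [embed, Matrix.of_apply, if_pos]
      · congr 1
        ext i
        simp
      · intro i hi
        simp [hi]
    have e3 : X x (b.piecewise x y) = X (b.piecewise y x) y := by
      rw [off_piecewise hX _ _ y, if_pos]
      · congr 1
        ext i
        by_cases hi : i ∈ b <;> simp [hi]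
      · intro i hi
        simp [hi]
    rw [e1, e2, e3, mul_comm]
  · intro z _ hz
    rw [embed, Matrix.of_apply, off_piecewise hX z y y]
    split_ifs with h1 h2
    · refine absurd (funext fun i => ?_) hz
      by_cases hi : i ∈ b
      · simp [hi, h2 i hi]
      · simp [hi, h1 i hi]
    all_goals simp
  · simp
  · intro z _ hz
    rw [embed, Matrix.of_apply, off_piecewise hX x z x]
    split_ifs with h1 h2
    · refine absurd (funext fun i => ?_) hz
      by_cases hi : i ∈ b
      · simp [hi, h1 i hi]
      · simp [hi, h2 i hi]
    all_goals simp
  · simp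

theorem embed_one (b : Finset (Fin n)) : embed b (1 : Matrix (b → Fin h) (b → Fin h) ℂ) = 1 := by
  ext x y
  rw [embed, Matrix.of_apply, Matrix.one_apply, Matrix.one_apply]
  by_cases hxy : x = y
  · simp [hxy]
  · rw [if_neg hxy]
    split_ifs with h1 h2
    · refine absurd (funext fun i => ?_) hxy
      by_cases hi : i ∈ b
      · exact congrFun h2 ⟨i, hi⟩
      · exact h1 i hi
    all_goals rfl

theorem embed_conjTranspose (b : Finset (Fin n)) (M : Matrix (b → Fin h) (b → Fin h) ℂ) :
    (embed b M)ᴴ = embed b Mᴴ := by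
  ext x y
  simp only [embed, Matrix.conjTranspose_apply, Matrix.of_apply, eq_comm (a := y _)]
  split_ifs <;> simp

theorem embed_mul (b : Finset (Fin n)) (M N : Matrix (b → Fin h) (b → Fin h) ℂ) :
    embed b M * embed b N = embed b (M * N) := by
  ext x y
  rw [Matrix.mul_apply]
  simp only [embed, Matrix.of_apply, Matrix.mul_apply]
  split_ifs with hxy
  · symm
    refine Finset.sum_of_injOn (fun w i => if hi : i ∈ b then w ⟨i, hi⟩ else x i) ?_ ?_ ?_ ?_
    · intro w _ w' _ hw
      ext ⟨i, hi⟩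
      have := congrFun hw i
      simpa [hi] using congrArg Fin.val this
    · intro w _
      simp
    · intro z _ hz
      rw [if_neg, zero_mul]
      intro hxz
      refine hz ⟨fun i => z i, by simp, funext fun i => ?_⟩
      by_cases hi : i ∈ b <;> simp [hi, hxz]
    · intro w _
      rw [if_pos, if_pos]
      · simp
      · intro i hi
        simp [hi, hxy i hi]
      · intro i hi
        simp [hi]
  · refine Finset.sum_eq_zero fun z _ => ?_
    split_ifs with h1 h2
    · exact absurd (fun i hi => (h1 i hi).trans (h2 i hi)) hxy
    all_goals simp

/-- The tensor product of the gates `g s` on the blocks `s ∈ A`. -/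
def blockProd (g : (s : Finset (Fin n)) → Matrix (s → Fin h) (s → Fin h) ℂ)
    (A : Finset (Finset (Fin n))) : QOp h n :=
  Matrix.of fun x y => if ∀ i, (∀ s ∈ A, i ∉ s) → x i = y i then
    ∏ s ∈ A, g s (fun i => x i) (fun i => y i) else 0

variable {g : (s : Finset (Fin n)) → Matrix (s → Fin h) (s → Fin h) ℂ}

theorem blockProd_empty : blockProd g ∅ = 1 := by
  ext x y
  simp [blockProd, Matrix.one_apply, funext_iff]

theorem blockProd_insert {A : Finset (Finset (Fin n))} {b : Finset (Fin n)} (hb : b ∉ A)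
    (hd : ∀ s ∈ A, Disjoint s b) : blockProd g (insert b A) = blockProd g A * embed b (g b) := by
  ext x y
  rw [Matrix.mul_apply, Finset.sum_eq_single (b.piecewise x y)]
  · have e1 : embed b (g b) (b.piecewise x y) y = g b (fun i => x i) (fun i => y i) := by
      rw [embed, Matrix.of_apply, if_pos]
      · congr 1
        ext i
        simp
      · intro i hi
        simp [hi]
    rw [e1]
    simp only [blockProd, Matrix.of_apply]
    have e2 : (∀ i, (∀ s ∈ A, i ∉ s) → x i = b.piecewise x y i) ↔
        ∀ i, (∀ s ∈ insert b A, i ∉ s) → x i = y i := by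
      refine forall_congr' fun i => ?_
      by_cases hi : i ∈ b <;> simp [hi]
    have e3 : ∏ s ∈ A, g s (fun i => x i) (fun i => b.piecewise x y i) =
        ∏ s ∈ A, g s (fun i => x i) (fun i => y i) := by
      refine Finset.prod_congr rfl fun s hs => ?_
      congr 1
      ext ⟨i, hi⟩
      simp [Finset.disjoint_left.1 (hd s hs) hi]
    rw [e3, Finset.prod_insert hb]
    simp only [e2]
    split_ifs <;> ring
  · intro z _ hz
    rw [embed, blockProd, Matrix.of_apply, Matrix.of_apply]
    split_ifs with h1 h2
    · refine absurd (funext fun i => ?_) hz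
      by_cases hi : i ∈ b
      · rw [Finset.piecewise_eq_of_mem _ _ _ hi,
          h1 i fun s hs his => Finset.disjoint_left.1 (hd s hs) his hi]
      · rw [Finset.piecewise_eq_of_notMem _ _ _ hi, h2 i hi]
    all_goals simp
  · simp

theorem blockProd_off {A : Finset (Finset (Fin n))} {i : Fin n} (hi : ∀ s ∈ A, i ∉ s) :
    Off i (blockProd g A) := by
  rw [off_iff]
  intro x y c
  simp only [blockProd, Matrix.of_apply]
  have e1 : ∏ s ∈ A, g s (fun k => update x i c k) (fun k => update y i c k) =
      ∏ s ∈ A, g s (fun k => x k) (fun k => y k) := by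
    refine Finset.prod_congr rfl fun s hs => ?_
    have hne : ∀ k : s, (k : Fin n) ≠ i := fun k hk => hi s hs (hk ▸ k.2)
    simp [hne]
  have e2 : (∀ k, (∀ s ∈ A, k ∉ s) → x k = y k) ↔
      x i = y i ∧ ∀ k, (∀ s ∈ A, k ∉ s) → update x i c k = update y i c k := by
    constructor
    · intro hk
      refine ⟨hk i hi, fun k hk' => ?_⟩
      by_cases hki : k = i
      · subst hki; simp
      · simp [hki, hk k hk']
    · rintro ⟨h1, h2⟩ k hk
      by_cases hki : k = i
      · exact hki ▸ h1
      · simpa [hki] using h2 k hk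
  rw [e1]
  by_cases h1 : x i = y i <;> simp [e2, h1]

theorem embed_mem_unitary {b : Finset (Fin n)} {M : Matrix (b → Fin h) (b → Fin h) ℂ}
    (hM : M ∈ Matrix.unitaryGroup (b → Fin h) ℂ) : embed b M ∈ unitary (QOp h n) := by
  rw [Matrix.mem_unitaryGroup_iff, star_eq_conjTranspose] at hM
  have h1 : embed b M * (embed b M)ᴴ = 1 := by
    rw [embed_conjTranspose, embed_mul, hM, embed_one]
  exact Matrix.mem_unitaryGroup_iff.2 h1

theorem blockProd_mem_unitary {A : Finset (Finset (Fin n))}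
    (hg : ∀ s ∈ A, g s ∈ Matrix.unitaryGroup (s → Fin h) ℂ)
    (hA : (A : Set (Finset (Fin n))).PairwiseDisjoint id) :
    blockProd g A ∈ unitary (QOp h n) := by
  induction A using Finset.induction_on with
  | empty => rw [blockProd_empty]; exact one_mem _
  | insert b A hb ih =>
    rw [blockProd_insert hb]
    · refine mul_mem (ih (fun s hs => hg s (Finset.mem_insert_of_mem hs)) (hA.subset ?_))
        (embed_mem_unitary (hg b (Finset.mem_insert_self _ _)))
      exact_mod_cast Finset.subset_insert b A
    · intro s hs
      exact hA (by simp [hs]) (by simp) (fun e => hb (e ▸ hs))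

variable {k d : ℕ} (𝒞 : LayeredCircuit h k n d)

theorem layerUnitary_eq (j : Fin d) : 𝒞.layerUnitary j =
    blockProd (fun s => (𝒞.gate j s : Matrix (s → Fin h) (s → Fin h) ℂ)) (𝒞.blocks j).parts := by
  ext x y
  rw [LayeredCircuit.layerUnitary, blockProd, Matrix.of_apply, Matrix.of_apply, if_pos]
  intro i hi
  obtain ⟨s, hs, his⟩ := (𝒞.blocks j).exists_mem (Finset.mem_univ i)
  exact absurd his (hi s hs)

theorem layerUnitary_mem (j : Fin d) : 𝒞.layerUnitary j ∈ unitary (QOp h n) := by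
  rw [layerUnitary_eq]
  exact blockProd_mem_unitary (fun s _ => (𝒞.gate j s).2) (𝒞.blocks j).disjoint

/-- Light-cone property. Write the layer as `V` times the gate `G` on `b`. Conjugation by `V` keeps
`X` trivial on `b`, so the result commutes with `G`, which then cancels against its adjoint. -/
theorem layer_conj_off {j : Fin d} {b : Finset (Fin n)} (hb : b ∈ (𝒞.blocks j).parts)
    {X : QOp h n} (hX : ∀ i ∈ b, Off i X) :
    ∀ i ∈ b, Off i ((𝒞.layerUnitary j)ᴴ * X * 𝒞.layerUnitary j) := by
  set g := fun s : Finset (Fin n) => (𝒞.gate j s : Matrix (s → Fin h) (s → Fin h) ℂ)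
  set V := blockProd g ((𝒞.blocks j).parts.erase b) with hV
  have hdis : ∀ s ∈ (𝒞.blocks j).parts.erase b, Disjoint s b := fun s hs =>
    (𝒞.blocks j).disjoint (Finset.mem_of_mem_erase hs) hb (Finset.ne_of_mem_erase hs)
  have hU : 𝒞.layerUnitary j = V * embed b (g b) := by
    rw [layerUnitary_eq, hV, ← blockProd_insert (Finset.notMem_erase _ _) hdis,
      Finset.insert_erase hb]
  have hVoff : ∀ i ∈ b, Off i V := fun i hi =>
    blockProd_off fun s hs his => Finset.disjoint_left.1 (hdis s hs) his hi
  have hY : ∀ i ∈ b, Off i (Vᴴ * X * V) := fun i hi =>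
    ((hVoff i hi).conjTranspose.mul (hX i hi)).mul (hVoff i hi)
  have hG : (embed b (g b))ᴴ * embed b (g b) = 1 :=
    (Unitary.mem_iff.1 (embed_mem_unitary (𝒞.gate j b).2)).1
  have e : (𝒞.layerUnitary j)ᴴ * X * 𝒞.layerUnitary j = Vᴴ * X * V := by
    rw [hU, conjTranspose_mul]
    calc _ = (embed b (g b))ᴴ * ((Vᴴ * X * V) * embed b (g b)) := by simp only [mul_assoc]
      _ = _ := by rw [(commute_embed hY (g b)).eq, ← mul_assoc, hG, one_mul]
  rw [e]
  exact hY

end NoisyCircuit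

/-! ### Selected parts of the noise: factorization and operator bounds -/

namespace NoisyCircuit

open Matrix Function
open scoped ComplexOrder

variable {h n : ℕ}

/-- The part of the noise on qudit `i` selected by `s`: its deviation from the completely
depolarizing channel if `i ∈ s`, and the completely depolarizing channel otherwise. -/
noncomputable def siteOp (s : Finset (Fin n)) (i : Fin n) : Module.End ℂ (QOp h n) :=
  if i ∈ s then 1 - dep i else dep i

/-- The operators `siteOp s i`, applied for all `i` in the list `l`. -/
noncomputable def noise (s : Finset (Fin n)) (l : List (Fin n)) : Module.End ℂ (QOp h n) :=
  (l.map (siteOp s)).prod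

theorem noise_nil (s : Finset (Fin n)) (X : QOp h n) : noise s [] X = X := by
  simp [noise]

theorem noise_cons (s : Finset (Fin n)) (i : Fin n) (l : List (Fin n)) (X : QOp h n) :
    noise s (i :: l) X = siteOp s i (noise s l X) := by
  simp [noise]

theorem siteOp_of_mem {s : Finset (Fin n)} {i : Fin n} (hi : i ∈ s) (X : QOp h n) :
    siteOp s i X = X - dep i X := by
  simp [siteOp, hi]

theorem siteOp_of_notMem {s : Finset (Fin n)} {i : Fin n} (hi : i ∉ s) (X : QOp h n) :
    siteOp s i X = dep i X := by
  simp [siteOp, hi]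

theorem Off.siteOp {i : Fin n} {X : QOp h n} (hX : Off i X) (s : Finset (Fin n)) (k : Fin n) :
    Off i (siteOp s k X) := by
  by_cases hk : k ∈ s
  · rw [siteOp_of_mem hk]
    exact hX.sub (hX.dep k)
  · rw [siteOp_of_notMem hk]
    exact hX.dep k

theorem Off.noise {i : Fin n} {X : QOp h n} (hX : Off i X) (s : Finset (Fin n))
    (l : List (Fin n)) : Off i (noise s l X) := by
  induction l with
  | nil => rwa [noise_nil]
  | cons k l ih =>
    rw [noise_cons]
    exact ih.siteOp s k

theorem noise_off {i : Fin n} {s : Finset (Fin n)} {l : List (Fin n)} (hl : i ∈ l) (hi : i ∉ s)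
    (X : QOp h n) : Off i (noise s l X) := by
  induction l with
  | nil => simp at hl
  | cons k l ih =>
    rw [noise_cons]
    rcases List.mem_cons.1 hl with rfl | hl
    · rw [siteOp_of_notMem hi]
      exact dep_off_self _ _
    · exact (ih hl).siteOp s k

/-- At every qudit one of the two factors is trivial and unselected. There `dep i` fixes that factor
and passes through it, so the site operator of the union acts on the other factor alone. -/
theorem noise_mul [NeZero h] {s t : Finset (Fin n)} {X Y : QOp h n} (l : List (Fin n))
    (hXY : ∀ i, (Off i Y ∧ i ∉ t) ∨ (Off i X ∧ i ∉ s)) :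
    noise (s ∪ t) l (X * Y) = noise s l X * noise t l Y := by
  induction l with
  | nil => simp only [noise_nil]
  | cons i l ih =>
    rw [noise_cons, noise_cons, noise_cons, ih]
    rcases hXY i with ⟨hY, hi⟩ | ⟨hX, hi⟩
    · have hY' := hY.noise t l
      rw [siteOp_of_notMem hi, dep_of_off hY']
      by_cases hs : i ∈ s
      · rw [siteOp_of_mem hs, siteOp_of_mem (Finset.mem_union_left _ hs), dep_mul_left hY', sub_mul]
      · rw [siteOp_of_notMem hs, siteOp_of_notMem (by simp [hs, hi]), dep_mul_left hY']
    · have hX' := hX.noise s l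
      rw [siteOp_of_notMem hi, dep_of_off hX']
      by_cases ht : i ∈ t
      · rw [siteOp_of_mem ht, siteOp_of_mem (Finset.mem_union_right _ ht), dep_mul_right hX',
          mul_sub]
      · rw [siteOp_of_notMem ht, siteOp_of_notMem (by simp [ht, hi]), dep_mul_right hX']

/-- `-c ≤ X ≤ c` in the order of Hermitian matrices. -/
def Bdd (c : ℝ) (X : QOp h n) : Prop :=
  ((c : ℂ) • (1 : QOp h n) - X).PosSemidef ∧ ((c : ℂ) • (1 : QOp h n) + X).PosSemidef

theorem dep_one [NeZero h] (i : Fin n) : dep i (1 : QOp h n) = 1 := dep_of_off (off_one i)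

/-- `dep i` is positive and unital, so it preserves two-sided bounds by multiples of the identity,
and `1 - dep i` at most doubles them. -/
theorem Bdd.siteOp [NeZero h] {c : ℝ} {X : QOp h n} (hX : Bdd c X) (s : Finset (Fin n))
    (i : Fin n) : Bdd ((if i ∈ s then 2 else 1) * c) (siteOp s i X) := by
  have h1 := dep_posSemidef i hX.1
  have h2 := dep_posSemidef i hX.2
  rw [map_sub, map_smul, dep_one] at h1
  rw [map_add, map_smul, dep_one] at h2
  by_cases hi : i ∈ s
  · rw [siteOp_of_mem hi, if_pos hi]
    constructor
    · convert hX.1.add h2 using 1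
      push_cast
      rw [mul_smul, two_smul]
      abel
    · convert hX.2.add h1 using 1
      push_cast
      rw [mul_smul, two_smul]
      abel
  · rw [siteOp_of_notMem hi, if_neg hi, one_mul]
    exact ⟨h1, h2⟩

theorem Bdd.noise [NeZero h] {c : ℝ} {X : QOp h n} (hX : Bdd c X) (s : Finset (Fin n)) :
    Bdd (2 ^ s.card * c) (noise s (List.finRange n) X) := by
  have key : ∀ l : List (Fin n),
      Bdd ((l.map fun i => if i ∈ s then (2 : ℝ) else 1).prod * c) (NoisyCircuit.noise s l X) := by
    intro l
    induction l with
    | nil => simpa [noise_nil] using hX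
    | cons i l ih =>
      rw [noise_cons, List.map_cons, List.prod_cons, mul_assoc]
      exact ih.siteOp s i
  have := key (List.finRange n)
  rw [← Fin.prod_univ_def, Finset.prod_ite_mem, Finset.univ_inter, Finset.prod_const] at this
  exact this

theorem Bdd.conj {c : ℝ} {X U : QOp h n} (hX : Bdd c X) (hU : U ∈ unitary (QOp h n)) :
    Bdd c (Uᴴ * X * U) := by
  have hU1 : Uᴴ * U = 1 := (Unitary.mem_iff.1 hU).1
  have h1 := hX.1.conjTranspose_mul_mul_same U
  have h2 := hX.2.conjTranspose_mul_mul_same U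
  constructor
  · convert h1 using 1
    rw [mul_sub, sub_mul, mul_smul_comm, smul_mul_assoc, mul_one, hU1]
  · convert h2 using 1
    rw [mul_add, add_mul, mul_smul_comm, smul_mul_assoc, mul_one, hU1]

theorem Bdd.mono {c c' : ℝ} {X : QOp h n} (hX : Bdd c X) (hc : c ≤ c') : Bdd c' X := by
  have h1 : (((c' - c : ℝ) : ℂ) • (1 : QOp h n)).PosSemidef := by
    refine PosSemidef.one.smul ?_
    exact_mod_cast sub_nonneg.2 hc
  constructor
  · convert hX.1.add h1 using 1
    push_cast
    rw [sub_smul]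
    abel
  · convert hX.2.add h1 using 1
    push_cast
    rw [sub_smul]
    abel

theorem Bdd.diag {c : ℝ} {X : QOp h n} (hX : Bdd c X) (z : Fin n → Fin h) :
    |(X z z).re| ≤ c ∧ (X z z).im = 0 := by
  have h1 := hX.1.diag_nonneg (i := z)
  have h2 := hX.2.diag_nonneg (i := z)
  simp only [Matrix.sub_apply, Matrix.add_apply, Matrix.smul_apply, Matrix.one_apply_eq,
    smul_eq_mul, mul_one, Complex.le_def, Complex.sub_re, Complex.add_re, Complex.sub_im,
    Complex.add_im, Complex.ofReal_re, Complex.ofReal_im, Complex.zero_re, Complex.zero_im] at h1 h2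
  refine ⟨abs_le.2 ⟨?_, ?_⟩, ?_⟩ <;> linarith [h1.1, h1.2, h2.1, h2.2]

theorem bdd_diagonal {c : ℝ} {v : (Fin n → Fin h) → ℝ} (hv : ∀ y, |v y| ≤ c) :
    Bdd c (diagonal fun y => (v y : ℂ)) := by
  have e : (c : ℂ) • (1 : QOp h n) = diagonal fun _ => (c : ℂ) := by
    rw [smul_one_eq_diagonal]
  constructor
  · rw [e, diagonal_sub, posSemidef_diagonal_iff]
    intro y
    have := (abs_le.1 (hv y)).2
    rw [← Complex.ofReal_sub]
    exact_mod_cast sub_nonneg.2 this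
  · rw [e, diagonal_add, posSemidef_diagonal_iff]
    intro y
    have := (abs_le.1 (hv y)).1
    rw [← Complex.ofReal_add]
    have h0 : 0 ≤ c + v y := by linarith
    exact_mod_cast h0

/-! ### The outcome observable under the last noise layer -/

/-- The observable `hⁿ |x⟩⟨x|`. -/
noncomputable def outcomeObs (x : Fin n → Fin h) : QOp h n :=
  diagonal fun y => ((∏ i, (h : ℝ) * if y i = x i then 1 else 0 : ℝ) : ℂ)

/-- The function `h δ_{b a} - 1` of `b` on the qudits of `s`, and `1` on the others. -/
noncomputable def localFactor (s : Finset (Fin n)) (i : Fin n) (a b : Fin h) : ℝ :=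
  if i ∈ s then (h : ℝ) * (if b = a then 1 else 0) - 1 else 1

theorem dep_diagonal (i : Fin n) (F : (Fin n → Fin h) → ℂ) :
    dep i (diagonal F) = diagonal fun y => (h : ℂ)⁻¹ * ∑ c, F (update y i c) := by
  ext x y
  rw [dep_apply, diagonal_apply]
  by_cases hxy : x = y
  · subst hxy
    simp
  · rw [if_neg hxy]
    split_ifs with hi
    · rw [Finset.sum_eq_zero, mul_zero]
      intro c _
      rw [diagonal_apply_ne]
      intro e
      apply hxy
      ext k
      by_cases hk : k = i
      · rw [hk, hi]
      · have := congrFun e k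
        simpa [hk] using congrArg Fin.val this
    · simp

theorem dep_diagonal_prod (i : Fin n) (φ : Fin n → Fin h → ℝ) :
    dep i (diagonal fun y : Fin n → Fin h => ((∏ k, φ k (y k) : ℝ) : ℂ)) =
      diagonal fun y => (((∏ k ∈ Finset.univ.erase i, φ k (y k)) *
        ((h : ℝ)⁻¹ * ∑ c, φ i c) : ℝ) : ℂ) := by
  rw [dep_diagonal]
  congr 1
  ext y
  push_cast
  have : ∀ c, ∏ k, (φ k (update y i c k) : ℂ) =
      (∏ k ∈ Finset.univ.erase i, (φ k (y k) : ℂ)) * φ i c := by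
    intro c
    rw [← Finset.prod_erase_mul _ _ (Finset.mem_univ i), update_self]
    congr 1
    refine Finset.prod_congr rfl fun k hk => ?_
    rw [update_of_ne (Finset.ne_of_mem_erase hk)]
  simp only [this, ← Finset.mul_sum]
  ring

theorem noise_outcomeObs_list [NeZero h] (s : Finset (Fin n)) (x : Fin n → Fin h)
    {l : List (Fin n)} (hl : l.Nodup) :
    noise s l (outcomeObs x) = diagonal fun y => ((∏ i, (if i ∈ l then localFactor s i (x i) (y i)
      else (h : ℝ) * if y i = x i then 1 else 0) : ℝ) : ℂ) := by
  have hh : (h : ℝ) ≠ 0 := by exact_mod_cast NeZero.ne h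
  induction l with
  | nil => simp [noise_nil, outcomeObs]
  | cons i l ih =>
    obtain ⟨hil, hl⟩ := List.nodup_cons.1 hl
    rw [noise_cons, ih hl]
    have hd := dep_diagonal_prod i (fun k b => if k ∈ l then localFactor s k (x k) b
      else (h : ℝ) * if b = x k then 1 else 0)
    simp only [hil, if_false, Finset.sum_ite_eq', Finset.mem_univ, if_true, mul_one,
      ← Finset.mul_sum, inv_mul_cancel₀ hh] at hd
    have hE : ∀ y : Fin n → Fin h, ∏ k ∈ Finset.univ.erase i,
        (if k ∈ i :: l then localFactor s k (x k) (y k)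
          else (h : ℝ) * if y k = x k then 1 else 0) =
        ∏ k ∈ Finset.univ.erase i, (if k ∈ l then localFactor s k (x k) (y k)
          else (h : ℝ) * if y k = x k then 1 else 0) := by
      intro y
      refine Finset.prod_congr rfl fun k hk => ?_
      simp [Finset.ne_of_mem_erase hk]
    by_cases hi : i ∈ s
    · rw [siteOp_of_mem hi, hd, diagonal_sub]
      congr 1
      ext y
      rw [← Complex.ofReal_sub]
      congr 1
      rw [← Finset.prod_erase_mul _ _ (Finset.mem_univ i),
        ← Finset.prod_erase_mul (a := i) Finset.univ (fun k => if k ∈ i :: l then _ else _)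
          (Finset.mem_univ i), hE]
      simp only [hil, if_false, List.mem_cons_self, if_true, localFactor, hi]
      ring
    · rw [siteOp_of_notMem hi, hd]
      congr 1
      ext y
      congr 1
      rw [← Finset.prod_erase_mul (a := i) Finset.univ (fun k => if k ∈ i :: l then _ else _)
          (Finset.mem_univ i), hE]
      simp [localFactor, hi]

theorem noise_outcomeObs [NeZero h] (s : Finset (Fin n)) (x : Fin n → Fin h) :
    noise s (List.finRange n) (outcomeObs x) =
      diagonal fun y => ((∏ i, localFactor s i (x i) (y i) : ℝ) : ℂ) := by
  rw [noise_outcomeObs_list s x (List.nodup_finRange n)]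
  simp

theorem localFactor_union {s t : Finset (Fin n)} (hst : Disjoint s t) (i : Fin n) (a b : Fin h) :
    localFactor (s ∪ t) i a b = localFactor s i a b * localFactor t i a b := by
  by_cases hs : i ∈ s
  · simp [localFactor, hs, Finset.disjoint_left.1 hst hs]
  · simp [localFactor, hs]

/-- The bare observable is not a product of two copies of itself, so `noise_mul` does not cover the
last layer. The scaling by `hⁿ` helps instead: an unselected site contributes the factor `1`, and
disjoint selections multiply. -/
theorem noise_outcomeObs_union [NeZero h] {s t : Finset (Fin n)} (hst : Disjoint s t)
    (x : Fin n → Fin h) : noise (s ∪ t) (List.finRange n) (outcomeObs x) =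
      noise s (List.finRange n) (outcomeObs x) * noise t (List.finRange n) (outcomeObs x) := by
  simp only [noise_outcomeObs, localFactor_union hst, Finset.prod_mul_distrib, diagonal_mul_diagonal,
    Complex.ofReal_mul]

theorem abs_localFactor_le [NeZero h] (s : Finset (Fin n)) (i : Fin n) (a b : Fin h) :
    |localFactor s i a b| ≤ if i ∈ s then (h : ℝ) else 1 := by
  have hh : (1 : ℝ) ≤ h := by exact_mod_cast NeZero.one_le
  unfold localFactor
  split_ifs <;> rw [abs_le] <;> constructor <;> linarith

theorem bdd_noise_outcomeObs [NeZero h] (s : Finset (Fin n)) (x : Fin n → Fin h) :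
    Bdd ((h : ℝ) ^ s.card) (noise s (List.finRange n) (outcomeObs x)) := by
  rw [noise_outcomeObs]
  refine bdd_diagonal fun y => ?_
  rw [Finset.abs_prod]
  refine (Finset.prod_le_prod (fun i _ => abs_nonneg _)
    (fun i _ => abs_localFactor_le s i (x i) (y i))).trans_eq ?_
  rw [Finset.prod_ite_mem, Finset.univ_inter, Finset.prod_const]

/-- The sum factorizes over qudits. Outside `L` a selected site gives `∑_b (h δ - 1) = 0`, and an
unselected one gives `h`. -/
theorem sum_localFactor [NeZero h] (s L : Finset (Fin n)) (x z : Fin n → Fin h) :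
    ∑ w : Fin n → Fin h, (if (fun i : L => w i) = fun i : L => x i then
      ∏ i, localFactor s i (w i) (z i) else 0) =
      if s ⊆ L then (h : ℝ) ^ (n - L.card) * ∏ i, localFactor s i (x i) (z i) else 0 := by
  have e : ∀ w : Fin n → Fin h, (if (fun i : L => w i) = fun i : L => x i then
      ∏ i, localFactor s i (w i) (z i) else 0) =
      ∏ i, (if i ∈ L → w i = x i then localFactor s i (w i) (z i) else 0) := by
    intro w
    have : ((fun i : L => w i) = fun i : L => x i) ↔ ∀ i ∈ (Finset.univ : Finset (Fin n)),
        (i ∈ L → w i = x i) := by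
      simp [funext_iff]
    simp only [this]
    rw [Finset.prod_ite_zero]
    congr
  simp only [e]
  have hsum := Finset.prod_univ_sum (fun _ : Fin n => (Finset.univ : Finset (Fin h)))
    (fun i b => if i ∈ L → b = x i then localFactor s i b (z i) else 0)
  rw [Fintype.piFinset_univ] at hsum
  rw [← hsum]
  have hloc : ∀ i, ∑ b, (if i ∈ L → b = x i then localFactor s i b (z i) else 0) =
      if i ∈ L then localFactor s i (x i) (z i) else if i ∈ s then 0 else (h : ℝ) := by
    intro i
    by_cases hL : i ∈ L
    · simp [hL]
    · by_cases hs : i ∈ s <;> simp [hL, hs, localFactor]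
  simp only [hloc]
  split_ifs with hsL
  · have : ∀ i, (if i ∈ L then localFactor s i (x i) (z i) else if i ∈ s then 0 else (h : ℝ)) =
        (if i ∈ Lᶜ then (h : ℝ) else 1) * localFactor s i (x i) (z i) := by
      intro i
      by_cases hL : i ∈ L
      · simp [hL]
      · have hs : i ∉ s := fun hs => hL (hsL hs)
        simp [hL, hs, localFactor]
    simp only [this, Finset.prod_mul_distrib]
    rw [Finset.prod_ite_mem, Finset.univ_inter, Finset.prod_const, Finset.card_compl,
      Fintype.card_fin]
  · obtain ⟨i, hs, hL⟩ := Finset.not_subset.1 hsL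
    exact Finset.prod_eq_zero (Finset.mem_univ i) (by simp [hs, hL])

end NoisyCircuit

/-! ### Backward evolution and the weight of a set of noise locations -/

namespace NoisyCircuit

open Matrix Function
open scoped ComplexOrder

variable {h n k d : ℕ} (𝒞 : LayeredCircuit h k n d)

/-- Conjugation by the unitary of layer `j`, in the Heisenberg picture. -/
noncomputable def layerConj (j : Fin d) : Module.End ℂ (QOp h n) :=
  LinearMap.mulLeft ℂ (𝒞.layerUnitary j)ᴴ * LinearMap.mulRight ℂ (𝒞.layerUnitary j)

theorem layerConj_apply (j : Fin d) (X : QOp h n) :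
    layerConj 𝒞 j X = (𝒞.layerUnitary j)ᴴ * X * 𝒞.layerUnitary j := by
  simp [layerConj, mul_assoc]

theorem layerConj_mul (j : Fin d) (X Y : QOp h n) :
    layerConj 𝒞 j (X * Y) = layerConj 𝒞 j X * layerConj 𝒞 j Y := by
  have hU : 𝒞.layerUnitary j * (𝒞.layerUnitary j)ᴴ = 1 :=
    (Unitary.mem_iff.1 (layerUnitary_mem 𝒞 j)).2
  simp only [layerConj_apply]
  calc _ = (𝒞.layerUnitary j)ᴴ * X * 1 * Y * 𝒞.layerUnitary j := by
        simp only [mul_assoc, one_mul]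
    _ = _ := by
        rw [← hU]
        simp only [mul_assoc]

/-- The qudits of `S` in noise layer `j`. -/
def slice (S : Finset (Fin n × Fin d)) (j : Fin d) : Finset (Fin n) :=
  Finset.univ.filter fun i => (i, j) ∈ S

theorem mem_slice {S : Finset (Fin n × Fin d)} {j : Fin d} {i : Fin n} :
    i ∈ slice S j ↔ (i, j) ∈ S := by
  simp [slice]

theorem slice_union (S T : Finset (Fin n × Fin d)) (j : Fin d) :
    slice (S ∪ T) j = slice S j ∪ slice T j := by
  ext i
  simp [mem_slice]

/-- Layer `j` in the Heisenberg picture, with the parts of the noise selected by `s`. -/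
noncomputable def layerOp (j : Fin d) (s : Finset (Fin n)) : Module.End ℂ (QOp h n) :=
  layerConj 𝒞 j * noise s (List.finRange n)

/-- The observable `hⁿ |x⟩⟨x|` evolved backwards through the layers from `j` on. -/
noncomputable def obs (S : Finset (Fin n × Fin d)) (x : Fin n → Fin h) (j : ℕ) : QOp h n :=
  (((List.finRange d).drop j).map fun j => layerOp 𝒞 j (slice S j)).prod (outcomeObs x)

theorem obs_of_le {S : Finset (Fin n × Fin d)} {x : Fin n → Fin h} {j : ℕ} (hj : d ≤ j) :
    obs 𝒞 S x j = outcomeObs x := by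
  rw [obs, List.drop_eq_nil_of_le (by simpa using hj)]
  simp

theorem obs_eq (S : Finset (Fin n × Fin d)) (x : Fin n → Fin h) (j : Fin d) :
    obs 𝒞 S x j =
      layerConj 𝒞 j (noise (slice S j) (List.finRange n) (obs 𝒞 S x (j + 1))) := by
  have hj : (j : ℕ) < (List.finRange d).length := by simp
  rw [obs, List.drop_eq_getElem_cons hj, List.map_cons, List.prod_cons, List.getElem_finRange,
    Module.End.mul_apply, layerOp, Module.End.mul_apply]
  rfl

/-- The observable `obs` right before the noise of layer `j`. -/
noncomputable def noisedObs (S : Finset (Fin n × Fin d)) (x : Fin n → Fin h) (j : Fin d) :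
    QOp h n :=
  noise (slice S j) (List.finRange n) (obs 𝒞 S x (j + 1))

theorem noisedObs_off {S : Finset (Fin n × Fin d)} {x : Fin n → Fin h} {j : Fin d} {i : Fin n}
    (hi : (i, j) ∉ S) : Off i (noisedObs 𝒞 S x j) :=
  noise_off (List.mem_finRange i) (by rwa [mem_slice]) _

theorem obs_off {S : Finset (Fin n × Fin d)} {x : Fin n → Fin h} {j : Fin d} {b : Finset (Fin n)}
    (hb : b ∈ (𝒞.blocks j).parts) (hS : ∀ i ∈ b, (i, j) ∉ S) :
    ∀ i ∈ b, Off i (obs 𝒞 S x j) := by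
  rw [obs_eq, layerConj_apply]
  exact layer_conj_off 𝒞 hb fun i hi => noisedObs_off 𝒞 (hS i hi)

theorem adj_of_mem_block {j : Fin d} {b : Finset (Fin n)} (hb : b ∈ (𝒞.blocks j).parts)
    {v w : Fin n × Fin d} (hv : v.1 ∈ b) (hw : w.1 ∈ b)
    (hvj : v.2 = j ∨ (v.2 : ℕ) + 1 = j) (hwj : w.2 = j ∨ (w.2 : ℕ) + 1 = j) (hvw : v ≠ w) :
    𝒞.interactionGraph.Adj v w := by
  rw [LayeredCircuit.interactionGraph, SimpleGraph.fromRel_adj]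
  refine ⟨hvw, ?_⟩
  rcases hvj with hvj | hvj <;> rcases hwj with hwj | hwj
  · left; left
    exact ⟨hvj.trans hwj.symm, b, hvj ▸ hb, hv, hw⟩
  · right; right; right
    subst hvj
    exact ⟨hwj.symm, b, hb, hw, hv⟩
  · left; right; right
    subst hwj
    exact ⟨hvj.symm, b, hb, hv, hw⟩
  · left; right; left
    exact ⟨Fin.ext (by omega), j, hvj.symm, b, hb, hv, hw⟩

-- The noise locations right before and right after one gate form a clique of the interaction graph,
-- so two disjoint non-adjacent sets cannot both meet them.
variable {𝒞} in
theorem not_both_touch {S T : Finset (Fin n × Fin d)} (hST : Disjoint S T)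
    (hadj : ∀ a ∈ S, ∀ b ∈ T, ¬ 𝒞.interactionGraph.Adj a b) {j : Fin d} {b : Finset (Fin n)}
    (hb : b ∈ (𝒞.blocks j).parts) :
    (∀ v ∈ S, v.1 ∈ b → v.2 ≠ j ∧ (v.2 : ℕ) + 1 ≠ j) ∨
      (∀ v ∈ T, v.1 ∈ b → v.2 ≠ j ∧ (v.2 : ℕ) + 1 ≠ j) := by
  by_contra hcon
  rw [not_or] at hcon
  obtain ⟨h1, h2⟩ := hcon
  push Not at h1 h2
  obtain ⟨v, hv, hvb, hvj⟩ := h1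
  obtain ⟨w, hw, hwb, hwj⟩ := h2
  refine hadj v hv w hw (adj_of_mem_block 𝒞 hb hvb hwb ?_ ?_ ?_)
  · exact or_iff_not_imp_left.2 hvj
  · exact or_iff_not_imp_left.2 hwj
  · exact fun e => Finset.disjoint_left.1 hST hv (e ▸ hw)

/-- Backward induction from the last layer. Each gate between noise layers `j` and `j + 1` is
touched by at most one of the two sets. For the other set, the evolved observable is trivial on that
block and nothing there is selected, which is what `noise_mul` requires. -/
theorem noisedObs_union [NeZero h] {S T : Finset (Fin n × Fin d)} (hST : Disjoint S T)
    (hadj : ∀ a ∈ S, ∀ b ∈ T, ¬ 𝒞.interactionGraph.Adj a b) (x : Fin n → Fin h) (m : ℕ) :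
    ∀ j : Fin d, (j : ℕ) + 1 + m = d →
      noisedObs 𝒞 (S ∪ T) x j = noisedObs 𝒞 S x j * noisedObs 𝒞 T x j := by
  induction m with
  | zero =>
    intro j hj
    simp only [noisedObs, obs_of_le 𝒞 (show d ≤ (j : ℕ) + 1 by omega), slice_union]
    refine noise_outcomeObs_union ?_ x
    rw [Finset.disjoint_left] at hST ⊢
    intro i hi hi'
    exact hST (mem_slice.1 hi) (mem_slice.1 hi')
  | succ m ih =>
    intro j hj
    have hj' : (j : ℕ) + 1 < d := by omega
    have ih := ih ⟨j + 1, hj'⟩ (by simp only; omega)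
    have e : ∀ R, obs 𝒞 R x ((j : ℕ) + 1) =
        layerConj 𝒞 ⟨j + 1, hj'⟩ (noisedObs 𝒞 R x ⟨j + 1, hj'⟩) := fun R =>
      obs_eq 𝒞 R x ⟨j + 1, hj'⟩
    have hmul : obs 𝒞 (S ∪ T) x ((j : ℕ) + 1) =
        obs 𝒞 S x ((j : ℕ) + 1) * obs 𝒞 T x ((j : ℕ) + 1) := by
      rw [e, ih, layerConj_mul, ← e, ← e]
    rw [noisedObs, hmul, slice_union]
    refine noise_mul _ fun i => ?_
    obtain ⟨b, hb, hib⟩ := (𝒞.blocks ⟨j + 1, hj'⟩).exists_mem (Finset.mem_univ i)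
    rcases not_both_touch hST hadj hb with hS | hT
    · right
      refine ⟨obs_off 𝒞 hb (fun i' hi' hmem => (hS _ hmem hi').1 rfl) i hib, ?_⟩
      rw [mem_slice]
      exact fun hmem => (hS _ hmem hib).2 rfl
    · left
      refine ⟨obs_off 𝒞 hb (fun i' hi' hmem => (hT _ hmem hi').1 rfl) i hib, ?_⟩
      rw [mem_slice]
      exact fun hmem => (hT _ hmem hib).2 rfl

/-- An intermediate configuration that differs from `z` at `i` is killed by whichever factor is
trivial on `i`. -/
theorem mul_apply_of_off {X Y : QOp h n} (hXY : ∀ i, Off i X ∨ Off i Y) (z : Fin n → Fin h) :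
    (X * Y) z z = X z z * Y z z := by
  rw [Matrix.mul_apply, Finset.sum_eq_single z]
  · intro w _ hw
    obtain ⟨i, hi⟩ := Function.ne_iff.1 hw
    rcases hXY i with hX | hY
    · rw [off_iff.1 hX z w (z i), if_neg (Ne.symm hi), zero_mul]
    · rw [off_iff.1 hY w z (z i), if_neg hi, mul_zero]
  · simp

/-- The contribution of the noise events `S` to `hⁿ` times the probability of `x`. -/
noncomputable def weight [NeZero h] (x : Fin n → Fin h) (S : Finset (Fin n × Fin d)) : ℝ :=
  (obs 𝒞 S x 0 (fun _ => 0) (fun _ => 0)).re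

/-- Unitary conjugation preserves the bounds. A selected location costs `h` in the last layer, by
the explicit formula there, and `2` in the earlier ones; `2h` covers both cases. -/
theorem bdd_noisedObs [NeZero h] (S : Finset (Fin n × Fin d)) (x : Fin n → Fin h) (m : ℕ) :
    ∀ j : Fin d, (j : ℕ) + 1 + m = d →
      Bdd ((2 * (h : ℝ)) ^ (S.filter fun v => j ≤ v.2).card) (noisedObs 𝒞 S x j) := by
  have hh : (1 : ℝ) ≤ h := by exact_mod_cast NeZero.one_le
  have hcard : ∀ j : Fin d, (slice S j).card = (S.filter fun v => v.2 = j).card := by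
    intro j
    refine Finset.card_bij (fun i _ => (i, j)) ?_ ?_ ?_
    · intro i hi
      simpa [mem_slice] using hi
    · intro i _ i' _ e
      exact (Prod.ext_iff.1 e).1
    · rintro ⟨i, j'⟩ hv
      rw [Finset.mem_filter] at hv
      obtain ⟨hv, rfl⟩ := hv
      exact ⟨i, mem_slice.2 hv, rfl⟩
  induction m with
  | zero =>
    intro j hj
    rw [noisedObs, obs_of_le 𝒞 (show d ≤ (j : ℕ) + 1 by omega)]
    refine (bdd_noise_outcomeObs (slice S j) x).mono ?_
    calc (h : ℝ) ^ (slice S j).card ≤ (2 * h) ^ (slice S j).card :=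
          pow_le_pow_left₀ (by positivity) (by linarith) _
      _ ≤ _ := by
          refine pow_le_pow_right₀ (by linarith) ?_
          rw [hcard]
          exact Finset.card_le_card
            (Finset.monotone_filter_right _ fun v _ (hv : v.2 = j) => hv.ge)
  | succ m ih =>
    intro j hj
    have hj' : (j : ℕ) + 1 < d := by omega
    have ih := ih ⟨j + 1, hj'⟩ (by simp only; omega)
    have e : obs 𝒞 S x ((j : ℕ) + 1) =
        layerConj 𝒞 ⟨j + 1, hj'⟩ (noisedObs 𝒞 S x ⟨j + 1, hj'⟩) := obs_eq 𝒞 S x ⟨j + 1, hj'⟩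
    rw [noisedObs, e, layerConj_apply]
    refine ((ih.conj (layerUnitary_mem 𝒞 _)).noise (slice S j)).mono ?_
    have hsplit : (S.filter fun v => j ≤ v.2).card =
        (slice S j).card + (S.filter fun v => (⟨j + 1, hj'⟩ : Fin d) ≤ v.2).card := by
      rw [hcard, ← Finset.card_union_of_disjoint]
      · congr 1
        ext v
        simp only [Finset.mem_filter, Finset.mem_union, Fin.le_def, Fin.ext_iff]
        constructor
        · rintro ⟨hv, hle⟩
          rcases hle.eq_or_lt with he | hlt
          · exact Or.inl ⟨hv, he.symm⟩
          · exact Or.inr ⟨hv, hlt⟩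
        · rintro (⟨hv, he⟩ | ⟨hv, hlt⟩)
          · exact ⟨hv, he.ge⟩
          · exact ⟨hv, by omega⟩
      · rw [Finset.disjoint_filter]
        intro v _ hv hlt
        rw [hv, Fin.le_def] at hlt
        simp at hlt
    rw [hsplit, pow_add]
    refine mul_le_mul_of_nonneg_right ?_ (by positivity)
    exact pow_le_pow_left₀ (by norm_num) (by linarith) _

theorem weight_bound [NeZero h] (x : Fin n → Fin h) (S : Finset (Fin n × Fin d)) (hd : 0 < d) :
    |weight 𝒞 x S| ≤ (2 * (h : ℝ)) ^ S.card ∧ (obs 𝒞 S x 0 (fun _ => 0) (fun _ => 0)).im = 0 := by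
  have h1 := bdd_noisedObs 𝒞 S x (d - 1) ⟨0, hd⟩ (by simp only; omega)
  have h2 := (h1.conj (layerUnitary_mem 𝒞 ⟨0, hd⟩)).diag (fun _ => 0)
  rw [← layerConj_apply, noisedObs, ← obs_eq 𝒞 S x ⟨0, hd⟩] at h2
  have e : (S.filter fun v => (⟨0, hd⟩ : Fin d) ≤ v.2) = S :=
    Finset.filter_true_of_mem fun v _ => Nat.zero_le _
  rwa [e] at h2

theorem weight_union [NeZero h] {S T : Finset (Fin n × Fin d)} (hST : Disjoint S T)
    (hadj : ∀ a ∈ S, ∀ b ∈ T, ¬ 𝒞.interactionGraph.Adj a b) (x : Fin n → Fin h) (hd : 0 < d) :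
    weight 𝒞 x (S ∪ T) = weight 𝒞 x S * weight 𝒞 x T := by
  have h1 := noisedObs_union 𝒞 hST hadj x (d - 1) ⟨0, hd⟩ (by simp only; omega)
  have e : ∀ R, obs 𝒞 R x 0 = layerConj 𝒞 ⟨0, hd⟩ (noisedObs 𝒞 R x ⟨0, hd⟩) := fun R =>
      obs_eq 𝒞 R x ⟨0, hd⟩
  have h2 : obs 𝒞 (S ∪ T) x 0 = obs 𝒞 S x 0 * obs 𝒞 T x 0 := by
    rw [e, h1, layerConj_mul, ← e, ← e]
  have hoff : ∀ i, Off i (obs 𝒞 S x 0) ∨ Off i (obs 𝒞 T x 0) := by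
    intro i
    obtain ⟨b, hb, hib⟩ := (𝒞.blocks ⟨0, hd⟩).exists_mem (Finset.mem_univ i)
    rcases not_both_touch hST hadj hb with hS | hT
    · exact Or.inl (obs_off 𝒞 hb (fun i' hi' hmem => (hS _ hmem hi').1 rfl) i hib)
    · exact Or.inr (obs_off 𝒞 hb (fun i' hi' hmem => (hT _ hmem hi').1 rfl) i hib)
  unfold weight
  -- Real parts multiply because the diagonal entries are real, a by-product of the order bounds.
  rw [h2, mul_apply_of_off hoff, Complex.mul_re, (weight_bound 𝒞 x S hd).2, zero_mul, sub_zero]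

/-! ### Expansion of the outcome distribution in noise locations -/

theorem trace_foldl {ι : Type*} (l : List ι) (T : ι → QOp h n → QOp h n)
    (T' : ι → Module.End ℂ (QOp h n)) (hT : ∀ i X ρ, trace (X * T i ρ) = trace (T' i X * ρ))
    (X ρ : QOp h n) :
    trace (X * l.foldl (fun σ i => T i σ) ρ) = trace ((l.map T').prod X * ρ) := by
  induction l generalizing ρ with
  | nil => simp
  -- The head of the list acts first on the state, hence last on the observable.
  | cons i l ih => rw [List.foldl_cons, ih, hT, List.map_cons, List.prod_cons, Module.End.mul_apply]

/-- The noise of rate `1 - q` on qudit `i`. -/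
noncomputable def noisySite (q : ℝ) (i : Fin n) : Module.End ℂ (QOp h n) :=
  dep i + (q : ℂ) • (1 - dep i)

theorem trace_mul_depolarize (q : ℝ) (i : Fin n) (X ρ : QOp h n) :
    trace (X * depolarize (1 - q) i ρ) = trace (noisySite q i X * ρ) := by
  rw [depolarize_eq, noisySite]
  simp only [LinearMap.add_apply, LinearMap.smul_apply, LinearMap.sub_apply, Module.End.one_apply,
    mul_add, add_mul, mul_sub, sub_mul, mul_smul_comm, smul_mul_assoc, trace_add, trace_sub,
    trace_smul, trace_mul_dep]

/-- The noisy circuit in the Heisenberg picture. -/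
noncomputable def heisenberg (q : ℝ) : Module.End ℂ (QOp h n) :=
  ((List.finRange d).map fun j =>
    layerConj 𝒞 j * ((List.finRange n).map (noisySite (h := h) q)).prod).prod

theorem trace_mul_zeroState [NeZero h] (X : QOp h n) :
    trace (X * zeroState h n) = X (fun _ => 0) (fun _ => 0) := by
  rw [trace, Finset.sum_eq_single (fun _ => 0)]
  · rw [Matrix.diag_apply, Matrix.mul_apply, Finset.sum_eq_single (fun _ => 0)]
    · simp [zeroState]
    · intro z _ hz
      simp [zeroState, hz]
    · simp
  · intro z _ hz
    rw [Matrix.diag_apply, Matrix.mul_apply]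
    exact Finset.sum_eq_zero fun w _ => by simp [zeroState, hz]
  · simp

theorem trace_mul_outputState [NeZero h] (q : ℝ) (X : QOp h n) :
    trace (X * 𝒞.outputState (1 - q)) = heisenberg 𝒞 q X (fun _ => 0) (fun _ => 0) := by
  rw [LayeredCircuit.outputState, trace_foldl _ _ (fun j =>
    layerConj 𝒞 j * ((List.finRange n).map (noisySite (h := h) q)).prod), trace_mul_zeroState,
    heisenberg]
  intro j X ρ
  rw [depolarizeAll, trace_foldl _ _ _ (trace_mul_depolarize q), Module.End.mul_apply,
    layerConj_apply]
  generalize ((List.finRange n).map (noisySite (h := h) q)).prod X = Y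
  rw [← mul_assoc, trace_mul_comm]
  simp only [mul_assoc]

theorem noisySite_prod (q : ℝ) : ((List.finRange n).map (noisySite (h := h) q)).prod =
    ∑ s : Finset (Fin n), (q : ℂ) ^ s.card • noise s (List.finRange n) := by
  -- The ordered product of non-commuting maps is multilinear, so it expands over the subsets of
  -- sites at which `q (1 - dep i)` is chosen.
  have h1 := (MultilinearMap.mkPiAlgebraFin ℂ n (Module.End ℂ (QOp h n))).map_add_univ
    (fun i => (q : ℂ) • (1 - dep i)) (fun i => dep i)
  rw [MultilinearMap.mkPiAlgebraFin_apply, List.ofFn_eq_map] at h1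
  have e : (fun i : Fin n => (q : ℂ) • (1 - dep i : Module.End ℂ (QOp h n))) + (fun i => dep i) =
      noisySite q := by
    ext1 i
    rw [Pi.add_apply, noisySite, add_comm]
  rw [e] at h1
  rw [h1]
  refine Finset.sum_congr rfl fun s _ => ?_
  have e2 : s.piecewise (fun i : Fin n => (q : ℂ) • (1 - dep i : Module.End ℂ (QOp h n)))
      (fun i => dep i) = s.piecewise (fun i => (q : ℂ) • siteOp s i) (siteOp s) := by
    ext1 i
    by_cases hi : i ∈ s <;> simp [hi, siteOp]
  rw [e2, MultilinearMap.map_piecewise_smul _ (fun _ => (q : ℂ)), Finset.prod_const,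
    MultilinearMap.mkPiAlgebraFin_apply, List.ofFn_eq_map]
  rfl

theorem sum_slice_card (S : Finset (Fin n × Fin d)) : ∑ j, (slice S j).card = S.card := by
  rw [Finset.card_eq_sum_card_fiberwise (f := Prod.snd) (t := Finset.univ) (by simp)]
  refine Finset.sum_congr rfl fun j _ => ?_
  refine Finset.card_bij (fun i _ => (i, j)) ?_ ?_ ?_
  · intro i hi
    simpa [mem_slice] using hi
  · intro i _ i' _ e
    exact (Prod.ext_iff.1 e).1
  · rintro ⟨i, j'⟩ hv
    rw [Finset.mem_filter] at hv
    obtain ⟨hv, rfl⟩ := hv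
    exact ⟨i, mem_slice.2 hv, rfl⟩

theorem heisenberg_eq (q : ℝ) : heisenberg 𝒞 q = ∑ S : Finset (Fin n × Fin d),
    (q : ℂ) ^ S.card • ((List.finRange d).map fun j => layerOp 𝒞 j (slice S j)).prod := by
  have h1 := (MultilinearMap.mkPiAlgebraFin ℂ d (Module.End ℂ (QOp h n))).map_sum
    (fun j (s : Finset (Fin n)) => (q : ℂ) ^ s.card • layerOp 𝒞 j s)
  rw [MultilinearMap.mkPiAlgebraFin_apply, List.ofFn_eq_map] at h1
  have e : (fun j => ∑ s : Finset (Fin n), (q : ℂ) ^ s.card • layerOp 𝒞 j s) = fun j =>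
      layerConj 𝒞 j * ((List.finRange n).map (noisySite (h := h) q)).prod := by
    ext1 j
    rw [noisySite_prod, Finset.mul_sum]
    simp only [mul_smul_comm, layerOp]
  rw [heisenberg, ← e, h1]
  symm
  refine Finset.sum_bij' (fun S _ => slice S)
    (fun r _ => Finset.univ.filter fun v : Fin n × Fin d => v.1 ∈ r v.2) ?_ ?_ ?_ ?_ ?_
  · simp
  · simp
  · intro S _
    ext v
    simp [mem_slice]
  · intro r _
    ext j i
    simp [mem_slice]
  · intro S _
    rw [MultilinearMap.map_smul_univ, MultilinearMap.mkPiAlgebraFin_apply, List.ofFn_eq_map,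
      Finset.prod_pow_eq_pow_sum, sum_slice_card]

theorem trace_outcomeObs_mul (x : Fin n → Fin h) (ρ : QOp h n) :
    trace (outcomeObs x * ρ) = (h : ℂ) ^ n * ρ x x := by
  rw [trace, Finset.sum_eq_single x]
  · simp [outcomeObs, diagonal_mul]
  · intro z _ hz
    obtain ⟨i, hi⟩ := Function.ne_iff.1 hz
    rw [Matrix.diag_apply, outcomeObs, diagonal_mul, Finset.prod_eq_zero (Finset.mem_univ i)]
    · simp
    · simp [hi]
  · simp

theorem measurementDist_eq [NeZero h] (q : ℝ) (x : Fin n → Fin h) :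
    (h : ℝ) ^ n * 𝒞.measurementDist (1 - q) x =
      ∑ S : Finset (Fin n × Fin d), q ^ S.card * weight 𝒞 x S := by
  have h1 := trace_mul_outputState 𝒞 q (outcomeObs x)
  rw [trace_outcomeObs_mul, heisenberg_eq, LinearMap.sum_apply, Matrix.sum_apply] at h1
  have h2 := congrArg Complex.re h1
  rw [Complex.re_sum] at h2
  have e : (h : ℂ) ^ n = ((h ^ n : ℝ) : ℂ) := by push_cast; rfl
  rw [e, Complex.re_ofReal_mul] at h2
  rw [LayeredCircuit.measurementDist, h2]
  refine Finset.sum_congr rfl fun S _ => ?_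
  rw [LinearMap.smul_apply, Matrix.smul_apply, smul_eq_mul, ← Complex.ofReal_pow,
    Complex.re_ofReal_mul, weight, obs, List.drop_zero]

theorem noisySite_one [NeZero h] (q : ℝ) (i : Fin n) : noisySite q i (1 : QOp h n) = 1 := by
  simp [noisySite, dep_one]

theorem heisenberg_one [NeZero h] (q : ℝ) : heisenberg 𝒞 q (1 : QOp h n) = 1 := by
  have aux : ∀ {ι : Type} (l : List ι) (T : ι → Module.End ℂ (QOp h n)), (∀ i, T i 1 = 1) →
      (l.map T).prod 1 = 1 := by
    intro ι l T hT
    induction l with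
    | nil => simp
    | cons i l ih => rw [List.map_cons, List.prod_cons, Module.End.mul_apply, ih, hT]
  refine aux _ _ fun j => ?_
  rw [Module.End.mul_apply, aux _ _ (noisySite_one q), layerConj_apply, mul_one]
  exact (Unitary.mem_iff.1 (layerUnitary_mem 𝒞 j)).1

theorem sum_measurementDist [NeZero h] (q : ℝ) : ∑ x, 𝒞.measurementDist (1 - q) x = 1 := by
  have h1 := trace_mul_outputState 𝒞 q 1
  rw [heisenberg_one, one_mul, Matrix.one_apply_eq, trace] at h1
  have h2 := congrArg Complex.re h1
  rw [Complex.re_sum, Complex.one_re] at h2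
  exact h2

/-! ### Marginals as partition functions -/

theorem weight_eq_linear [NeZero h] (S : Finset (Fin n × Fin d)) (l : Fin d)
    (hl : (l : ℕ) + 1 = d) : ∃ Λ : QOp h n →ₗ[ℝ] ℝ, ∀ x, weight 𝒞 x S =
      Λ (diagonal fun y => ((∏ i, localFactor (slice S l) i (x i) (y i) : ℝ) : ℂ)) := by
  -- The outcome `x` enters only through the diagonal operator left by the last noise layer. The
  -- rest of the evolution is a linear functional independent of `x`, so sums over outcomes can be
  -- taken inside it.
  let Λ : QOp h n →ₗ[ℝ] ℝ :=
    { toFun := fun X => (((((List.finRange d).take l).map fun j =>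
        layerOp 𝒞 j (slice S j)).prod (layerConj 𝒞 l X)) (fun _ => 0) (fun _ => 0)).re
      map_add' := by intro X Y; simp
      map_smul' := by
        intro c X
        rw [← Complex.coe_smul, map_smul, map_smul, Matrix.smul_apply, smul_eq_mul,
          Complex.re_ofReal_mul]
        rfl }
  refine ⟨Λ, fun x => ?_⟩
  have e : obs 𝒞 S x 0 = (((List.finRange d).take l).map fun j =>
      layerOp 𝒞 j (slice S j)).prod (obs 𝒞 S x l) := by
    unfold obs
    rw [← Module.End.mul_apply, ← List.prod_append, ← List.map_append, List.take_append_drop,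
      List.drop_zero]
  rw [weight, e, obs_eq, obs_of_le 𝒞 hl.ge, noise_outcomeObs]
  rfl

/-- The noise locations that influence the marginal on `L`. -/
def region (l : Fin d) (L : Finset (Fin n)) : Finset (Fin n × Fin d) :=
  Finset.univ.filter fun v => v.2 = l → v.1 ∈ L

theorem subset_region_iff {l : Fin d} {L : Finset (Fin n)} {S : Finset (Fin n × Fin d)} :
    S ⊆ region l L ↔ slice S l ⊆ L := by
  constructor
  · intro hS i hi
    have := hS (mem_slice.1 hi)
    simpa [region] using this
  · rintro hS ⟨i, j⟩ hv
    simp only [region, Finset.mem_filter, Finset.mem_univ, true_and]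
    rintro rfl
    exact hS (mem_slice.2 hv)

theorem sum_weight [NeZero h] (S : Finset (Fin n × Fin d)) (l : Fin d) (hl : (l : ℕ) + 1 = d)
    (L : Finset (Fin n)) (x : Fin n → Fin h) :
    ∑ w : Fin n → Fin h, (if (fun i : L => w i) = fun i : L => x i then weight 𝒞 w S else 0) =
      if slice S l ⊆ L then (h : ℝ) ^ (n - L.card) * weight 𝒞 x S else 0 := by
  obtain ⟨Λ, hΛ⟩ := weight_eq_linear 𝒞 S l hl
  have e : ∀ w : Fin n → Fin h,
      (if (fun i : L => w i) = fun i : L => x i then weight 𝒞 w S else 0) =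
      Λ (diagonal fun y => ((if (fun i : L => w i) = fun i : L => x i then
        ∏ i, localFactor (slice S l) i (w i) (y i) else 0 : ℝ) : ℂ)) := by
    intro w
    split_ifs
    · exact hΛ w
    · have : (diagonal fun _ : Fin n → Fin h => ((0 : ℝ) : ℂ)) = 0 := by simp
      rw [this, map_zero]
  simp only [e]
  rw [← map_sum]
  have e2 : ∑ w : Fin n → Fin h, (diagonal fun y : Fin n → Fin h =>
      ((if (fun i : L => w i) = fun i : L => x i then
        ∏ i, localFactor (slice S l) i (w i) (y i) else 0 : ℝ) : ℂ)) =
      diagonal fun y => ((∑ w : Fin n → Fin h, (if (fun i : L => w i) = fun i : L => x i then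
        ∏ i, localFactor (slice S l) i (w i) (y i) else 0) : ℝ) : ℂ) := by
    ext a b
    rw [Matrix.sum_apply]
    by_cases hab : a = b
    · subst hab
      simp only [diagonal_apply_eq]
      push_cast
      rfl
    · simp [diagonal_apply_ne _ hab]
  rw [e2]
  simp only [sum_localFactor]
  split_ifs with hs
  · rw [hΛ, ← smul_eq_mul, ← map_smul]
    congr 1
    ext a b
    by_cases hab : a = b
    · subst hab
      simp
    · simp [diagonal_apply_ne _ hab]
  · simp

theorem marginal_eq [NeZero h] (q : ℝ) (l : Fin d) (hl : (l : ℕ) + 1 = d) (L : Finset (Fin n))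
    (x : Fin n → Fin h) :
    marginal (𝒞.measurementDist (1 - q)) L (fun i : L => x i) =
      ((h : ℝ) ^ L.card)⁻¹ *
        PolymerGas.Z (fun S => q ^ S.card * weight 𝒞 x S) (region l L) := by
  have hh : (h : ℝ) ≠ 0 := by exact_mod_cast NeZero.ne h
  have hP : ∀ w, 𝒞.measurementDist (1 - q) w = ((h : ℝ) ^ n)⁻¹ *
      ∑ S : Finset (Fin n × Fin d), q ^ S.card * weight 𝒞 w S := by
    intro w
    rw [← measurementDist_eq, inv_mul_cancel_left₀ (pow_ne_zero _ hh)]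
  have hL : L.card ≤ n := by simpa using Finset.card_le_univ L
  have e : ∀ w : Fin n → Fin h, (if (fun i : L => w i) = fun i : L => x i then
      𝒞.measurementDist (1 - q) w else 0) = ((h : ℝ) ^ n)⁻¹ *
        ∑ S : Finset (Fin n × Fin d), q ^ S.card *
          (if (fun i : L => w i) = fun i : L => x i then weight 𝒞 w S else 0) := by
    intro w
    split_ifs
    · exact hP w
    · simp
  have hpow : ((h : ℝ) ^ n)⁻¹ * (h : ℝ) ^ (n - L.card) = ((h : ℝ) ^ L.card)⁻¹ := by
    have : (h : ℝ) ^ n = (h : ℝ) ^ (n - L.card) * (h : ℝ) ^ L.card := by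
      rw [← pow_add, Nat.sub_add_cancel hL]
    rw [this]
    field_simp
  rw [marginal]
  simp only [e]
  rw [← Finset.mul_sum, Finset.sum_comm]
  have e2 : ∀ S : Finset (Fin n × Fin d), ∑ w : Fin n → Fin h, q ^ S.card *
      (if (fun i : L => w i) = fun i : L => x i then weight 𝒞 w S else 0) =
      if slice S l ⊆ L then q ^ S.card * ((h : ℝ) ^ (n - L.card) * weight 𝒞 x S) else 0 := by
    intro S
    rw [← Finset.mul_sum, sum_weight 𝒞 S l hl, mul_ite, mul_zero]
  simp only [e2]
  rw [← Finset.sum_filter, ← hpow, mul_assoc, PolymerGas.Z]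
  refine congrArg _ ?_
  rw [Finset.mul_sum]
  refine Finset.sum_congr ?_ fun S _ => by ring
  ext S
  simp [subset_region_iff]

end NoisyCircuit

/-! ### Conditional mutual information of the output -/

namespace NoisyCircuit

open PolymerGas

/-- Averaging over full outcomes puts all four entropies under the same expectation, so their
logarithms can be combined pointwise in `x`. -/
theorem marginalEntropy_eq {h n : ℕ} (P : (Fin n → Fin h) → ℝ) (L : Finset (Fin n)) :
    marginalEntropy P L = ∑ x, P x * -Real.log (marginal P L fun i : L => x i) := by
  have e : ∀ y : L → Fin h, Real.negMulLog (marginal P L y) = ∑ x : Fin n → Fin h,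
      if (fun i : L => x i) = y then P x * -Real.log (marginal P L y) else 0 := by
    intro y
    rw [Real.negMulLog]
    nth_rewrite 1 [marginal]
    rw [neg_mul_comm, Finset.sum_mul]
    exact Finset.sum_congr rfl fun x _ => by rw [ite_mul, zero_mul]
  rw [marginalEntropy, Finset.sum_congr rfl fun y _ => e y, Finset.sum_comm]
  refine Finset.sum_congr rfl fun x _ => ?_
  rw [Finset.sum_ite_eq, if_pos (Finset.mem_univ _)]

variable {h n k d : ℕ} (𝒞 : LayeredCircuit h k n d)

theorem condMutualInfo_symm (P : (Fin n → Fin h) → ℝ) (A B C : Finset (Fin n)) :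
    condMutualInfo P A B C = condMutualInfo P C B A := by
  have e : C ∪ B ∪ A = A ∪ B ∪ C := by
    rw [Finset.union_comm, Finset.union_comm C, Finset.union_assoc]
  rw [condMutualInfo, condMutualInfo, e, Finset.union_comm B C, Finset.union_comm B A,
    add_comm (marginalEntropy P (A ∪ B))]

theorem regionDist_comm (A C : Finset (Fin n)) : 𝒞.regionDist A C = 𝒞.regionDist C A := by
  have key : ∀ A C, 𝒞.regionDist A C ≤ 𝒞.regionDist C A := by
    intro A C
    refine le_iInf fun v => le_iInf fun w => le_iInf fun hv => le_iInf fun hw => ?_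
    rw [SimpleGraph.edist_comm]
    exact iInf_le_of_le w (iInf_le_of_le v (iInf_le_of_le hw (iInf_le_of_le hv le_rfl)))
  exact le_antisymm (key A C) (key C A)

theorem regionDist_le {A C : Finset (Fin n)} {v w : Fin n × Fin d} (hv : v.1 ∈ A) (hw : w.1 ∈ C) :
    𝒞.regionDist A C ≤ 𝒞.interactionGraph.edist v w :=
  iInf_le_of_le v (iInf_le_of_le w (iInf_le_of_le hv (iInf_le_of_le hw le_rfl)))

open Classical in
/-- The noise locations in the region `A` that have a neighbour outside. -/
noncomputable def innerBoundary (A : Finset (Fin n)) : Finset (Fin n × Fin d) :=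
  Finset.univ.filter fun v => v.1 ∈ A ∧ ∃ u : Fin n × Fin d, u.1 ∉ A ∧ 𝒞.interactionGraph.Adj v u

theorem mem_innerBoundary {A : Finset (Fin n)} {v : Fin n × Fin d} :
    v ∈ innerBoundary 𝒞 A ↔
      v.1 ∈ A ∧ ∃ u : Fin n × Fin d, u.1 ∉ A ∧ 𝒞.interactionGraph.Adj v u := by
  classical
  simp [innerBoundary]

/-- Choose an outgoing edge at each vertex. Such an edge has only one end over `A`, so distinct
vertices get distinct edges. -/
theorem card_innerBoundary_le (A : Finset (Fin n)) :
    (innerBoundary 𝒞 A).card ≤ (𝒞.edgeBoundary A).ncard := by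
  classical
  have hex : ∀ v : Fin n × Fin d, ∃ u : Fin n × Fin d,
      v ∈ innerBoundary 𝒞 A → u.1 ∉ A ∧ 𝒞.interactionGraph.Adj v u := by
    intro v
    by_cases hv : v ∈ innerBoundary 𝒞 A
    · obtain ⟨u, hu⟩ := ((mem_innerBoundary 𝒞).1 hv).2
      exact ⟨u, fun _ => hu⟩
    · exact ⟨v, fun hv' => absurd hv' hv⟩
  choose u hu using hex
  rw [← Set.ncard_coe_finset]
  refine Set.ncard_le_ncard_of_injOn (fun v => s(v, u v)) ?_ ?_ (Set.toFinite _)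
  · intro v hv
    exact ⟨(hu v hv).2, v, u v, rfl, ((mem_innerBoundary 𝒞).1 hv).1, (hu v hv).1⟩
  · intro v hv v' hv' e
    rcases Sym2.eq_iff.1 e with ⟨h1, -⟩ | ⟨h1, -⟩
    · exact h1
    · exact absurd (h1 ▸ ((mem_innerBoundary 𝒞).1 hv).1) (hu v' hv').1

/-- At `q = 0` only the empty set survives in the expansion of the marginal on `∅`, which is the
total probability `1`. -/
theorem weight_empty [NeZero h] (x : Fin n → Fin h) (hd : 0 < d) : weight 𝒞 x ∅ = 1 := by
  have h1 := marginal_eq 𝒞 0 ⟨d - 1, by omega⟩ (by simp only; omega) ∅ x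
  rw [Z, Finset.sum_eq_single ∅] at h1
  · have h2 : marginal (𝒞.measurementDist (1 - 0)) ∅ (fun i : (∅ : Finset (Fin n)) => x i) = 1 := by
      rw [marginal]
      refine Eq.trans ?_ (sum_measurementDist 𝒞 0)
      refine Finset.sum_congr rfl fun w _ => if_pos (funext fun i => ?_)
      exact absurd i.2 (Finset.notMem_empty _)
    rw [h2] at h1
    simpa using h1.symm
  · intro S _ hS
    rw [zero_pow (Finset.card_ne_zero.2 (Finset.nonempty_iff_ne_empty.2 hS)), zero_mul]
  · simp

/-- The weight of a set of noise locations in the expansion of the outcome distribution. -/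
noncomputable def noiseWeight [NeZero h] (q : ℝ) (x : Fin n → Fin h)
    (S : Finset (Fin n × Fin d)) : ℝ := q ^ S.card * weight 𝒞 x S

theorem factorizes_noiseWeight [NeZero h] (q : ℝ) (x : Fin n → Fin h) (hd : 0 < d) :
    Factorizes 𝒞.interactionGraph (noiseWeight 𝒞 q x) where
  empty := by simp [noiseWeight, weight_empty 𝒞 x hd]
  union S T hST hadj := by
    rw [noiseWeight, weight_union 𝒞 hST hadj x hd, Finset.card_union_of_disjoint hST, pow_add,
      noiseWeight, noiseWeight]
    ring

theorem abs_noiseWeight_le [NeZero h] {q : ℝ} (hq : 0 ≤ q) (x : Fin n → Fin h) (hd : 0 < d)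
    (S : Finset (Fin n × Fin d)) : |noiseWeight 𝒞 q x S| ≤ (2 * h * q) ^ S.card := by
  rw [noiseWeight, abs_mul, abs_of_nonneg (pow_nonneg hq _), mul_pow (2 * (h : ℝ)), mul_comm]
  exact mul_le_mul_of_nonneg_right (weight_bound 𝒞 x S hd).1 (pow_nonneg hq _)

/-- If the noise is strong, the conditional mutual information decays with the distance. -/
theorem condMutualInfo_le [NeZero h] {q ε δ : ℝ} {Δ : ℕ} (l : Fin d) (hl : (l : ℕ) + 1 = d)
    (hreg : ∀ x, Regime 𝒞.interactionGraph (noiseWeight 𝒞 q x) Δ (2 * h * q) ε) {m : ℕ}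
    (hδ : 0 ≤ δ) (hr : ∀ x u Y Y', u ∉ Y → u ∉ Y' → AgreeNear 𝒞.interactionGraph m u Y Y' →
      |ratio (noiseWeight 𝒞 q x) u Y - ratio (noiseWeight 𝒞 q x) u Y'| ≤ δ)
    {A B C : Finset (Fin n)} (hAB : Disjoint A B) (hBC : Disjoint B C) (hAC : Disjoint A C)
    (hm : (m : ℕ∞) ≤ 𝒞.regionDist A C) :
    condMutualInfo (𝒞.measurementDist (1 - q)) A B C ≤
      2 * (𝒞.edgeBoundary A).ncard * ((1 - ε)⁻¹ * δ) := by
  classical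
  have hh : (h : ℝ) ≠ 0 := by exact_mod_cast NeZero.ne h
  have hhpos : (0 : ℝ) < h := by exact_mod_cast NeZero.pos h
  set P := 𝒞.measurementDist (1 - q) with hP
  have hlog : ∀ L x, Real.log (marginal P L fun i : L => x i) =
      -(L.card * Real.log h) + Real.log (Z (noiseWeight 𝒞 q x) (region l L)) := by
    intro L x
    have e : marginal P L (fun i : L => x i) =
        ((h : ℝ) ^ L.card)⁻¹ * Z (noiseWeight 𝒞 q x) (region l L) := marginal_eq 𝒞 q l hl L x
    rw [e, Real.log_mul (by positivity) ((hreg x).Z_pos _).ne', Real.log_inv, Real.log_pow]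
  -- Nonnegativity comes from the expansion: `hⁿ P(x)` is the partition function on all locations,
  -- which is positive in this regime.
  have hPpos : ∀ x, 0 ≤ P x := by
    intro x
    have h1 := measurementDist_eq 𝒞 q x
    have h2 := (hreg x).Z_pos Finset.univ
    rw [Z, Finset.powerset_univ] at h2
    have h3 : 0 < (h : ℝ) ^ n * P x := by
      rw [hP, h1]
      exact h2
    exact (pos_of_mul_pos_right h3 (by positivity)).le
  have hcard : ((A ∪ B).card : ℝ) + (B ∪ C).card = B.card + (A ∪ B ∪ C).card := by
    rw [Finset.card_union_of_disjoint (Finset.disjoint_union_left.2 ⟨hAC, hBC⟩),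
      Finset.card_union_of_disjoint hAB, Finset.card_union_of_disjoint hBC]
    push_cast
    ring
  have hdist : ∀ v u : Fin n × Fin d, v.1 ∈ A → 𝒞.interactionGraph.edist v u < m → u.1 ∉ C :=
    fun v u hv hu hC => absurd ((regionDist_le 𝒞 hv hC).trans_lt hu) (not_lt.2 hm)
  have hcross : ∀ x,
      |Real.log (Z (noiseWeight 𝒞 q x) (region l (A ∪ B ∪ C))) -
        Real.log (Z (noiseWeight 𝒞 q x) (region l (A ∪ B))) -
        Real.log (Z (noiseWeight 𝒞 q x) (region l (B ∪ C))) +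
        Real.log (Z (noiseWeight 𝒞 q x) (region l B))| ≤
      2 * (innerBoundary 𝒞 A).card * ((1 - ε)⁻¹ * δ) := by
    intro x
    -- Here `R` consists of all locations over `A`; `a₁` and `a₀` keep or drop its last layer, and
    -- `y₁` and `y₀` keep or drop the last layer over `C`. The four unions are the regions of `A ∪ B
    -- ∪ C`, `A ∪ B`, `B ∪ C` and `B`.
    have key := (hreg x).abs_cross_le (hr x)
      (R := Finset.univ.filter fun v : Fin n × Fin d => v.1 ∈ A) (D := innerBoundary 𝒞 A)
      (a₁ := Finset.univ.filter fun v : Fin n × Fin d => v.1 ∈ A)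
      (a₀ := Finset.univ.filter fun v : Fin n × Fin d => v.1 ∈ A ∧ v.2 ≠ l)
      (y₁ := Finset.univ.filter fun v : Fin n × Fin d => v.1 ∉ A ∧ (v.2 = l → v.1 ∈ B ∪ C))
      (y₀ := Finset.univ.filter fun v : Fin n × Fin d => v.1 ∉ A ∧ (v.2 = l → v.1 ∈ B))
      (fun v => by simp +contextual) subset_rfl
      (Finset.disjoint_filter.2 fun v _ hv hA => hv.1 hA)
      (Finset.disjoint_filter.2 fun v _ hv hA => hv.1 hA)
      (fun v hv => by simpa using ((mem_innerBoundary 𝒞).1 hv).1)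
      (fun v hv hvD u hu hadj => hvD ((mem_innerBoundary 𝒞).2
        ⟨by simpa using hv, u, by simpa using hu, hadj⟩))
      (fun v hv u hu => by
        have := hdist v u ((mem_innerBoundary 𝒞).1 hv).1 hu
        simp [this])
    have e : ∀ (L : Finset (Fin n)) (a y : Fin n × Fin d → Prop) [DecidablePred a]
        [DecidablePred y],
        (∀ v, (v.2 = l → v.1 ∈ L) ↔ (a v ∨ y v)) →
        Finset.univ.filter a ∪ Finset.univ.filter y = region l L := by
      intro L a y _ _ hay
      rw [← Finset.filter_or, region]
      exact Finset.filter_congr fun v _ => (hay v).symm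
    have hBA : ∀ i ∈ A, i ∉ B := fun i hi => Finset.disjoint_left.1 hAB hi
    have hCA : ∀ i ∈ A, i ∉ C := fun i hi => Finset.disjoint_left.1 hAC hi
    rw [e (A ∪ B ∪ C), e (A ∪ B), e (B ∪ C), e B] at key
    · exact key
    all_goals
      intro v
      have h1 := hBA v.1
      have h2 := hCA v.1
      try simp only [Finset.mem_union]
      tauto
  have hI : condMutualInfo P A B C = ∑ x, P x *
      (Real.log (Z (noiseWeight 𝒞 q x) (region l (A ∪ B ∪ C))) -
        Real.log (Z (noiseWeight 𝒞 q x) (region l (A ∪ B))) -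
        Real.log (Z (noiseWeight 𝒞 q x) (region l (B ∪ C))) +
        Real.log (Z (noiseWeight 𝒞 q x) (region l B))) := by
    rw [condMutualInfo]
    simp only [marginalEntropy_eq]
    rw [← Finset.sum_add_distrib, ← Finset.sum_sub_distrib, ← Finset.sum_sub_distrib]
    refine Finset.sum_congr rfl fun x _ => ?_
    simp only [hlog]
    linear_combination P x * Real.log h * hcard
  rw [hI]
  have hb : 0 ≤ (1 - ε)⁻¹ * δ :=
    mul_nonneg (by linarith [(hreg fun _ => 0).one_le_inv]) hδ
  have hle : ((innerBoundary 𝒞 A).card : ℝ) ≤ (𝒞.edgeBoundary A).ncard := by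
    exact_mod_cast card_innerBoundary_le 𝒞 A
  calc _ ≤ ∑ x, P x * (2 * (𝒞.edgeBoundary A).ncard * ((1 - ε)⁻¹ * δ)) := by
        refine Finset.sum_le_sum fun x _ => mul_le_mul_of_nonneg_left ?_ (hPpos x)
        refine (le_abs_self _).trans ((hcross x).trans ?_)
        exact mul_le_mul_of_nonneg_right (by linarith) hb
    _ = _ := by rw [← Finset.sum_mul, hP, sum_measurementDist, one_mul]

/-! ### Numerical constants -/

theorem qCrit_zero_neg (h k : ℕ) [NeZero h] : qCrit h k 0 < 0 := by
  have hh : (0 : ℝ) < h := by exact_mod_cast NeZero.pos h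
  have he := Real.add_one_lt_exp (one_ne_zero (α := ℝ))
  rw [qCrit, inv_lt_zero]
  refine mul_neg_of_neg_of_pos (mul_neg_of_pos_of_neg (by positivity) ?_) ?_
  · push_cast
    linarith
  · push_cast
    linarith

theorem qCrit_pos (h k : ℕ) [NeZero h] {Δ : ℕ} (hΔ : 1 ≤ Δ) : 0 < qCrit h k Δ := by
  have hh : (0 : ℝ) < h := by exact_mod_cast NeZero.pos h
  have hΔ' : (0 : ℝ) ≤ Δ - 1 := sub_nonneg.2 (by exact_mod_cast hΔ)
  rw [qCrit]
  positivity

/-- All that is used of the threshold: `h ≤ h^k`, `Δ ≤ 1 + e (Δ - 1)` and `2 ≤ Δ + 1`. -/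
theorem two_mul_qCrit_le (h : ℕ) {k : ℕ} [NeZero h] {Δ : ℕ} (hk : 1 ≤ k) (hΔ : 1 ≤ Δ) :
    2 * h * qCrit h k Δ ≤ (4 * Real.exp 1 * Δ)⁻¹ := by
  have hh : (1 : ℝ) ≤ h := by exact_mod_cast NeZero.one_le
  have hΔ' : (1 : ℝ) ≤ Δ := by exact_mod_cast hΔ
  have hhk : (h : ℝ) ≤ (h : ℝ) ^ k := by simpa using pow_le_pow_right₀ hh hk
  have he := Real.add_one_lt_exp (one_ne_zero (α := ℝ))
  have h1 : (Δ : ℝ) ≤ 1 + Real.exp 1 * (Δ - 1) := by nlinarith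
  have hpos : (0 : ℝ) < 1 + Real.exp 1 * (Δ - 1) := by linarith
  have h2 : (4 * Real.exp 1 * Δ) * (2 * h) ≤
      2 * (h : ℝ) ^ k * (1 + Real.exp 1 * ((Δ : ℝ) - 1)) * (2 * Real.exp 1 * ((Δ : ℝ) + 1)) :=
    calc (4 * Real.exp 1 * Δ) * (2 * h) = 2 * h * Δ * (2 * Real.exp 1 * (1 + 1)) := by ring
      _ ≤ _ := by gcongr
  have h3 : 0 < 2 * (h : ℝ) ^ k * (1 + Real.exp 1 * ((Δ : ℝ) - 1)) *
      (2 * Real.exp 1 * ((Δ : ℝ) + 1)) := by positivity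
  rw [qCrit, ← div_eq_mul_inv, div_le_iff₀ h3, inv_mul_eq_div, le_div_iff₀ (by positivity)]
  linarith

theorem one_add_inv_pow_le {Δ : ℕ} (hΔ : 1 ≤ Δ) : (1 + (Δ : ℝ)⁻¹) ^ Δ ≤ Real.exp 1 := by
  have hΔ' : (Δ : ℝ) ≠ 0 := by exact_mod_cast (by omega : Δ ≠ 0)
  calc (1 + (Δ : ℝ)⁻¹) ^ Δ ≤ Real.exp (Δ : ℝ)⁻¹ ^ Δ := by
        refine pow_le_pow_left₀ (by positivity) ?_ _
        rw [add_comm]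
        exact Real.add_one_le_exp _
    _ = Real.exp 1 := by rw [← Real.exp_nat_mul, mul_inv_cancel₀ hΔ']

/-- The value of `ε` for which the expansion is shown to converge. -/
noncomputable def epsilon (Δ : ℕ) : ℝ := (8 * (Δ : ℝ))⁻¹

theorem epsilon_pos {Δ : ℕ} (hΔ : 1 ≤ Δ) : 0 < epsilon Δ := by
  have : (1 : ℝ) ≤ Δ := by exact_mod_cast hΔ
  unfold epsilon
  positivity

theorem epsilon_le {Δ : ℕ} (hΔ : 1 ≤ Δ) : epsilon Δ ≤ 1 / 8 := by
  have : (1 : ℝ) ≤ Δ := by exact_mod_cast hΔ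
  rw [epsilon, inv_le_comm₀ (by positivity) (by norm_num)]
  linarith

/-- Bernoulli's inequality gives `(1 - ε)^Δ ≥ 1 - Δ ε = 7/8`. -/
theorem inv_pow_epsilon_le {Δ : ℕ} (hΔ : 1 ≤ Δ) : ((1 - epsilon Δ)⁻¹) ^ Δ ≤ 8 / 7 := by
  have hΔ' : (0 : ℝ) < Δ := by exact_mod_cast hΔ
  have h1 := one_add_mul_le_pow (a := -epsilon Δ) (by linarith [epsilon_le hΔ]) Δ
  have h2 : (Δ : ℝ) * epsilon Δ = 1 / 8 := by
    rw [epsilon]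
    field_simp
  rw [inv_pow, inv_le_comm₀ (pow_pos (by linarith [epsilon_le hΔ]) _) (by norm_num)]
  rw [← sub_eq_add_neg] at h1
  linarith

theorem small_of_le {w : ℝ} {Δ : ℕ} (hΔ : 1 ≤ Δ)
    (hw : w ≤ (4 * Real.exp 1 * Δ)⁻¹) :
    w * ((1 - epsilon Δ)⁻¹) ^ Δ ≤ epsilon Δ / (1 + epsilon Δ) ^ Δ := by
  have hε := epsilon_pos hΔ
  have hε' := epsilon_le hΔ
  have hΔ' : (0 : ℝ) < Δ := by exact_mod_cast hΔ
  have hl := inv_pow_epsilon_le hΔ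
  have h1 : (1 + epsilon Δ) ^ Δ ≤ 8 / 7 := by
    refine le_trans (pow_le_pow_left₀ (by linarith) ?_ _) hl
    rw [← one_div, le_div_iff₀ (by linarith)]
    nlinarith
  rw [le_div_iff₀ (by positivity)]
  -- The condition reduces to `(8/7)² / (4e) ≤ 1/8`, that is `128/49 ≤ e`.
  have he := Real.exp_one_gt_d9
  calc w * ((1 - epsilon Δ)⁻¹) ^ Δ * (1 + epsilon Δ) ^ Δ
      ≤ (4 * Real.exp 1 * Δ)⁻¹ * (8 / 7) * (8 / 7) := by
        have : 0 ≤ (1 - epsilon Δ)⁻¹ := inv_nonneg.2 (by linarith)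
        gcongr
    _ ≤ epsilon Δ := by
        rw [epsilon, mul_assoc, inv_mul_eq_div, div_le_iff₀ (by positivity), inv_mul_eq_div,
          le_div_iff₀ (by positivity)]
        nlinarith

/-- Source of the factor `4/7`: the loss `8/7` times `1/4` is `(4/7)/2`, and `(1 + Δ⁻¹)^Δ ≤ e`
accounts for the rest. -/
theorem decay_of_le {w t θ : ℝ} {Δ : ℕ} (hΔ : 1 ≤ Δ) (hw0 : 0 ≤ w)
    (hw : w ≤ t * (4 * Real.exp 1 * Δ)⁻¹) (hθ0 : 0 ≤ θ) (hθ : 4 / 7 * t ≤ θ) :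
    w * ((1 - epsilon Δ)⁻¹) ^ Δ ≤ θ / 2 * ((Δ : ℝ)⁻¹ / (1 + (Δ : ℝ)⁻¹) ^ Δ) := by
  have hΔ' : (0 : ℝ) < Δ := by exact_mod_cast hΔ
  calc w * ((1 - epsilon Δ)⁻¹) ^ Δ ≤ t * (4 * Real.exp 1 * Δ)⁻¹ * (8 / 7) :=
        mul_le_mul hw (inv_pow_epsilon_le hΔ)
          (pow_nonneg (inv_nonneg.2 (by linarith [epsilon_le hΔ])) _) (hw0.trans hw)
    _ = (4 / 7 * t) / 2 * ((Δ : ℝ)⁻¹ / Real.exp 1) := by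
        field_simp
        ring
    _ ≤ θ / 2 * ((Δ : ℝ)⁻¹ / (1 + (Δ : ℝ)⁻¹) ^ Δ) := by
        have := one_add_inv_pow_le hΔ
        gcongr

/-! ### Assembling the bound -/

theorem nbrs_card_le_degree (v : Fin n × Fin d) :
    (nbrs 𝒞.interactionGraph v).card ≤ 𝒞.degree := by
  classical
  rw [LayeredCircuit.degree]
  refine le_trans (le_of_eq ?_) (SimpleGraph.degree_le_maxDegree _ v)
  rw [← SimpleGraph.card_neighborFinset_eq_degree]
  congr 1
  ext u
  simp [nbrs]

theorem pos_of_degree_pos (hdeg : 1 ≤ 𝒞.degree) : 0 < d ∧ 1 ≤ k := by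
  classical
  have hne : Nonempty (Fin n × Fin d) := by
    by_contra hemp
    rw [not_nonempty_iff] at hemp
    rw [LayeredCircuit.degree, SimpleGraph.maxDegree_of_subsingleton] at hdeg
    omega
  obtain ⟨i, j⟩ := hne
  refine ⟨j.pos, ?_⟩
  obtain ⟨s, hs, his⟩ := (𝒞.blocks j).exists_mem (Finset.mem_univ i)
  exact (Finset.card_pos.2 ⟨i, his⟩).trans_le (𝒞.card_le j s hs)

theorem condMutualInfo_le_pow [NeZero h] {q θ : ℝ} (hq : 0 ≤ q) (hdeg : 1 ≤ 𝒞.degree)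
    (hqc : q ≤ qCrit h k 𝒞.degree) (hθ0 : 0 < θ) (hθ1 : θ ≤ 1)
    (hθ : 4 / 7 * (q / qCrit h k 𝒞.degree) ≤ θ) {m : ℕ} {A B C : Finset (Fin n)}
    (hAB : Disjoint A B) (hBC : Disjoint B C) (hAC : Disjoint A C)
    (hm : (m : ℕ∞) ≤ 𝒞.regionDist A C) :
    condMutualInfo (𝒞.measurementDist (1 - q)) A B C ≤
      8 * (𝒞.edgeBoundary A).ncard * θ ^ m := by
  obtain ⟨hd, hk⟩ := pos_of_degree_pos 𝒞 hdeg
  set Δ := 𝒞.degree with hΔdef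
  have hqcpos := qCrit_pos h k hdeg
  have hw0 : 0 ≤ 2 * h * q := by positivity
  have hE : (0 : ℝ) ≤ (4 * Real.exp 1 * Δ)⁻¹ := by positivity
  have hw : 2 * h * q ≤ q / qCrit h k Δ * (4 * Real.exp 1 * Δ)⁻¹ := by
    have h1 := mul_le_mul_of_nonneg_left (two_mul_qCrit_le h hk hdeg)
      (div_nonneg hq hqcpos.le)
    refine le_trans (le_of_eq ?_) h1
    field_simp
  have hw' : 2 * h * q ≤ (4 * Real.exp 1 * Δ)⁻¹ :=
    hw.trans (mul_le_of_le_one_left hE ((div_le_one hqcpos).2 hqc))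
  have hε := epsilon_le hdeg
  have hreg : ∀ x : Fin n → Fin h,
      Regime 𝒞.interactionGraph (noiseWeight 𝒞 q x) Δ (2 * h * q) (epsilon Δ) := fun x =>
    { factorizes := factorizes_noiseWeight 𝒞 q x hd
      bound := abs_noiseWeight_le 𝒞 hq x hd
      nbrs_card_le := nbrs_card_le_degree 𝒞
      w_nonneg := hw0
      eps_pos := epsilon_pos hdeg
      eps_lt := by linarith
      small := small_of_le hdeg hw' }
  have hl : (1 - epsilon Δ)⁻¹ ≤ 8 / 7 := by
    rw [inv_le_comm₀ (by linarith) (by norm_num)]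
    linarith
  have hfinal := condMutualInfo_le 𝒞 (δ := 3 * θ ^ m) ⟨d - 1, by omega⟩ (by simp only; omega) hreg
    (by positivity) (fun x => (hreg x).abs_ratio_sub_le hdeg hθ0 hθ1 hl
      (decay_of_le hdeg hw0 hw hθ0.le hθ) m) hAB hBC hAC hm
  refine hfinal.trans ?_
  have hθm : 0 < θ ^ m := by positivity
  -- `(8/7) · 3 = 24/7` is rounded up to `4`, which gives the constant `8`.
  calc 2 * ((𝒞.edgeBoundary A).ncard : ℝ) * ((1 - epsilon Δ)⁻¹ * (3 * θ ^ m))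
      ≤ 2 * ((𝒞.edgeBoundary A).ncard : ℝ) * (4 * θ ^ m) := by
        refine mul_le_mul_of_nonneg_left ?_ (by positivity)
        nlinarith
    _ = _ := by ring

theorem condMutualInfo_le_min [NeZero h] {q θ : ℝ} (hq : 0 ≤ q) (hdeg : 1 ≤ 𝒞.degree)
    (hqc : q ≤ qCrit h k 𝒞.degree) (hθ0 : 0 < θ) (hθ1 : θ ≤ 1)
    (hθ : 4 / 7 * (q / qCrit h k 𝒞.degree) ≤ θ) {m : ℕ} {A B C : Finset (Fin n)}
    (hAB : Disjoint A B) (hBC : Disjoint B C) (hAC : Disjoint A C)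
    (hm : (m : ℕ∞) ≤ 𝒞.regionDist A C) :
    condMutualInfo (𝒞.measurementDist (1 - q)) A B C ≤
      8 * (min (𝒞.edgeBoundary A).ncard (𝒞.edgeBoundary C).ncard : ℕ) * θ ^ m := by
  rcases min_choice (𝒞.edgeBoundary A).ncard (𝒞.edgeBoundary C).ncard with e | e <;> rw [e]
  · exact condMutualInfo_le_pow 𝒞 hq hdeg hqc hθ0 hθ1 hθ hAB hBC hAC hm
  · rw [condMutualInfo_symm]
    rw [regionDist_comm] at hm
    exact condMutualInfo_le_pow 𝒞 hq hdeg hqc hθ0 hθ1 hθ hBC.symm hAB.symm hAC.symm hm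

theorem condMutualInfo_le_expDecay [NeZero h] {q θ : ℝ} (hq : 0 ≤ q) (hdeg : 1 ≤ 𝒞.degree)
    (hqc : q ≤ qCrit h k 𝒞.degree) (hθ0 : 0 < θ) (hθ1 : θ < 1)
    (hθ : 4 / 7 * (q / qCrit h k 𝒞.degree) ≤ θ) {A B C : Finset (Fin n)}
    (hAB : Disjoint A B) (hBC : Disjoint B C) (hAC : Disjoint A C) :
    condMutualInfo (𝒞.measurementDist (1 - q)) A B C ≤
      8 * (min (𝒞.edgeBoundary A).ncard (𝒞.edgeBoundary C).ncard : ℕ) *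
        expDecay (𝒞.regionDist A C) (-Real.log θ)⁻¹ := by
  have key : ∀ m : ℕ, (m : ℕ∞) ≤ 𝒞.regionDist A C → _ := fun m hm =>
    condMutualInfo_le_min 𝒞 hq hdeg hqc hθ0 hθ1.le hθ hAB hBC hAC (m := m) hm
  rw [expDecay]
  split_ifs with htop
  -- At infinite distance the bound holds for every `m`; let `m → ∞`.
  · have ht := (tendsto_pow_atTop_nhds_zero_of_lt_one hθ0.le hθ1).const_mul
      (8 * ((min (𝒞.edgeBoundary A).ncard (𝒞.edgeBoundary C).ncard : ℕ) : ℝ))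
    exact ge_of_tendsto' ht fun m => key m (htop ▸ le_top)
  · have h1 := key (𝒞.regionDist A C).toNat (ENat.natCast_toNat htop).le
    have h2 : Real.exp (-((𝒞.regionDist A C).toNat : ℝ) / (-Real.log θ)⁻¹) =
        θ ^ (𝒞.regionDist A C).toNat := by
      rw [div_inv_eq_mul, neg_mul_neg, Real.exp_nat_mul, Real.exp_log hθ0]
    rwa [h2]

end NoisyCircuit

theorem theorem2 :
    ∃ c K : ℝ, 0 < c ∧ 0 < K ∧
      ∀ (h k 𝔡 : ℕ) [NeZero h] (q : ℝ), 0 ≤ q → q ≤ qCrit h k 𝔡 →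
        ∃ ξ : ℝ, 0 < ξ ∧ ξ * Real.log (qCrit h k 𝔡 / q) ≤ K ∧
          ∀ (n d : ℕ) (𝒞 : LayeredCircuit h k n d), 𝒞.degree = 𝔡 →
            ∀ A B C : Finset (Fin n), Disjoint A B → Disjoint B C → Disjoint A C →
              condMutualInfo (𝒞.measurementDist (1 - q)) A B C ≤
                c * (min (𝒞.edgeBoundary A).ncard (𝒞.edgeBoundary C).ncard : ℕ) *
                  expDecay (𝒞.regionDist A C) ξ := by
  refine ⟨8, 1, by norm_num, one_pos, fun h k 𝔡 _ q hq hqc => ?_⟩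
  -- For `𝔡 = 0` the factor `1 + e (𝔡 - 1) = 1 - e` makes the threshold negative, so no `q ≥ 0` is
  -- admitted.
  have h𝔡 : 1 ≤ 𝔡 := by
    rcases Nat.eq_zero_or_pos 𝔡 with rfl | hpos
    · linarith [NoisyCircuit.qCrit_zero_neg h k]
    · exact hpos
  have hpos := NoisyCircuit.qCrit_pos h k h𝔡
  have hle : q / qCrit h k 𝔡 ≤ 1 := (div_le_one hpos).2 hqc
  -- The choice is `θ = (4/7) q / q_c`, which stays below `1` even at `q = q_c`, with `ξ = 1 / (-log
  -- θ)`. For `q = 0` this would be `0`, so `θ = 1/2` is taken; division by zero and `log 0 = 0`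
  -- then make the condition on `ξ` trivial.
  obtain ⟨θ, hθ0, hθ1, hθ, hlog⟩ : ∃ θ : ℝ, 0 < θ ∧ θ < 1 ∧ 4 / 7 * (q / qCrit h k 𝔡) ≤ θ ∧
      Real.log (qCrit h k 𝔡 / q) ≤ -Real.log θ := by
    rcases hq.eq_or_lt with rfl | hq0
    · refine ⟨1 / 2, by norm_num, by norm_num, by norm_num, ?_⟩
      rw [div_zero, Real.log_zero, le_neg, neg_zero]
      exact Real.log_nonpos (by norm_num) (by norm_num)
    · have hr : 0 < q / qCrit h k 𝔡 := div_pos hq0 hpos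
      refine ⟨4 / 7 * (q / qCrit h k 𝔡), by positivity, by linarith, le_rfl, ?_⟩
      rw [← inv_div, Real.log_inv, neg_le_neg_iff]
      exact Real.log_le_log (by positivity) (by linarith)
  have hneg : 0 < -Real.log θ := neg_pos.2 (Real.log_neg hθ0 hθ1)
  refine ⟨(-Real.log θ)⁻¹, inv_pos.2 hneg, ?_, ?_⟩
  · rw [inv_mul_eq_div, div_le_one hneg]
    exact hlog
  · rintro n d 𝒞 rfl A B C hAB hBC hAC
    exact NoisyCircuit.condMutualInfo_le_expDecay 𝒞 hq h𝔡 hqc hθ0 hθ1 hθ hAB hBC hAC
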